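/- Let $(\Omega,\mathcal F,\mathbb P)$ be a probability space with a filtration $(\mathcal F_t)_{t\ge 0}$, and let $(W_t)_{t\ge 0}$ be a standard real Brownian motion relative to $(\mathcal F_t)$, i.e. $W$ is adapted, $W_t-W_s$ is independent of $\mathcal F_s$ for $0\le s\le t$, and almost all paths of $W$ are continuous. Let $0\le a<b<\infty$, let $\Phi\in C^1(\mathbb R,\mathbb R)$, and put $\lambda=255/512$. For a partition $\Delta=\{a=t_0<t_1<\dots<t_n=b\}$ of $[a,b]$ write $\|\Delta\|=\max_{1\le j\le n}(t_j-t_{j-1})$ and $t_j^*=\lambda t_j+(1-\lambda)t_{j-1}$. Then the limit in probability $$\int_a^b\Phi(W_t)\star\mathrm dW_t:=\lim_{\|\Delta\|\to0}\sum_{j=1}^n\Phi(W_{t_j^*})\,(W_{t_j}-W_{t_{j-1}})$$ (the Fehlberg $255/512$-integral) exists. Moreover the Itô integral $\int_a^b\Phi(W_t)\,\mathrm dW_t$ exists, $\int_a^b\Phi'(W_t)\,\mathrm dt$ is almost surely well defined, and $$\int_a^b\Phi(W_t)\star\mathrm dW_t=\int_a^b\Phi(W_t)\,\mathrm dW_t+\frac{255}{512}\int_a^b\Phi'(W_t)\,\mathrm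 dt\qquad\text{almost surely.}$$ Here the Itô integral of an adapted process $f$ whose paths are almost surely measurable with $\int_a^b|f_t|^2\,\mathrm dt<\infty$ is the limit in probability of $\sum_j\xi_j^{(n)}\bigl(W_{t_j^{(n)}}-W_{t_{j-1}^{(n)}}\bigr)$ along any sequence of simple processes $H^{(n)}=\sum_j\xi_j^{(n)}\mathbf 1_{(t_{j-1}^{(n)},t_j^{(n)}]}$, with $\xi_j^{(n)}$ bounded and $\mathcal F_{t_{j-1}^{(n)}}$-measurable, such that $\int_a^b|H^{(n)}_t-f_t|^2\,\mathrm dt\to0$ in probability. -/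

import Mathlib

open MeasureTheory ProbabilityTheory Filter Topology
open scoped NNReal ENNReal

noncomputable section

/-- A partition `a = t_0 < t_1 < ... < t_n = b` of the time interval `[a, b]`. -/
structure TimePartition (a b : ℝ≥0) where
  /-- the number of subintervals -/
  n : ℕ
  /-- the partition points -/
  pt : Fin (n + 1) → ℝ≥0
  strictMono : StrictMono pt
  first : pt 0 = a
  last : pt (Fin.last n) = b

namespace TimePartition

variable {a b : ℝ≥0}

/-- The diameter of the partition, `max_j (t_j - t_{j-1})`. -/
def diam (π : TimePartition a b) : ℝ≥0 :=
  Finset.univ.sup fun j : Fin π.n => π.pt j.succ - π.pt j.castSucc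

/-- The filter describing the limit "as the diameter of the partition tends to zero", over all
partitions of `[a, b]`. -/
def diamToZero (a b : ℝ≥0) : Filter (TimePartition a b) :=
  comap diam (𝓝 0)

/-- The evaluation point `λ t_j + (1 - λ) t_{j-1}`, with `λ = 255/512`, of the subinterval
`[t_{j-1}, t_j]`. -/
def fehlbergPt (π : TimePartition a b) (j : Fin π.n) : ℝ≥0 :=
  (255 / 512) * π.pt j.succ + (1 - 255 / 512) * π.pt j.castSucc

end TimePartition

variable {Ω : Type*} {mΩ : MeasurableSpace Ω}

/-- `W` is a standard real Brownian motion relative to the filtration `𝓕`: it is a Brownian motion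
(with almost surely continuous paths), it is adapted to `𝓕`, and its increments after time `s` are
independent of `𝓕 s`. -/
structure IsFilteredBrownian (W : ℝ≥0 → Ω → ℝ) (𝓕 : Filtration ℝ≥0 mΩ) (P : Measure Ω) :
    Prop where
  isBrownian : IsBrownianReal W P
  adapted : StronglyAdapted 𝓕 W
  indep : ∀ s t : ℝ≥0, s ≤ t →
    Indep (MeasurableSpace.comap (fun ω => W t ω - W s ω) inferInstance) (𝓕 s) P

/-- The Riemann sum `∑_j Φ(W_{t_j^*}) (W_{t_j} - W_{t_{j-1}})`,
where `t_j^* = λ t_j + (1 - λ) t_{j-1}` and `λ = 255/512`. -/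
def fehlbergSum (W : ℝ≥0 → Ω → ℝ) (Φ : ℝ → ℝ) {a b : ℝ≥0} (π : TimePartition a b) (ω : Ω) : ℝ :=
  ∑ j : Fin π.n,
    Φ (W (π.fehlbergPt j) ω) * (W (π.pt j.succ) ω - W (π.pt j.castSucc) ω)

/-- `S` is (a version of) the Fehlberg `255/512`-integral of `Φ(W)` over `[a, b]` with respect to
`W`: the limit in probability of the Riemann sums as the diameter of the partition tends to zero. -/
def IsFehlbergIntegral (P : Measure Ω) (W : ℝ≥0 → Ω → ℝ) (Φ : ℝ → ℝ) (a b : ℝ≥0) (S : Ω → ℝ) :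
    Prop :=
  AEMeasurable S P ∧
    TendstoInMeasure P (fun π : TimePartition a b => fehlbergSum W Φ π)
      (TimePartition.diamToZero a b) S

/-- A simple process `∑_j ξ_j 1_{(t_{j-1}, t_j]}` on `[a, b]`, with `ξ_j` bounded and
measurable with respect to `𝓕 t_{j-1}`. -/
structure ItoSimpleProcess (𝓕 : Filtration ℝ≥0 mΩ) (a b : ℝ≥0) extends TimePartition a b where
  /-- the random value on each subinterval -/
  ξ : Fin n → Ω → ℝ
  measurable_ξ : ∀ j, Measurable[𝓕 (pt j.castSucc)] (ξ j)
  bounded_ξ : ∀ j, ∃ C : ℝ, ∀ ω, |ξ j ω| ≤ C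

namespace ItoSimpleProcess

variable {𝓕 : Filtration ℝ≥0 mΩ} {a b : ℝ≥0}

/-- The value of the simple process at time `t`. -/
def val (H : ItoSimpleProcess 𝓕 a b) (t : ℝ≥0) (ω : Ω) : ℝ :=
  ∑ j : Fin H.n, (Set.Ioc (H.pt j.castSucc) (H.pt j.succ)).indicator (fun _ => H.ξ j ω) t

/-- The stochastic integral `∑_j ξ_j (W_{t_j} - W_{t_{j-1}})` of a simple process. -/
def integral (H : ItoSimpleProcess 𝓕 a b) (W : ℝ≥0 → Ω → ℝ) (ω : Ω) : ℝ :=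
  ∑ j : Fin H.n, H.ξ j ω * (W (H.pt j.succ) ω - W (H.pt j.castSucc) ω)

end ItoSimpleProcess

/-- `I` is (a version of) the Itô integral `∫_a^b f_t dW_t`. The integrand `f` is adapted to `𝓕`,
almost all of its paths are measurable with `∫_a^b |f_t|² dt < ∞`, and `I` is the limit in
probability of the integrals of some simple processes `H_n` with `∫_a^b |H_n - f|² dt → 0` in
probability. -/
def IsItoIntegral (P : Measure Ω) (𝓕 : Filtration ℝ≥0 mΩ) (W f : ℝ≥0 → Ω → ℝ) (a b : ℝ≥0)
    (I : Ω → ℝ) : Prop :=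
  AEMeasurable I P ∧
  StronglyAdapted 𝓕 f ∧
  (∀ᵐ ω ∂P, MemLp (fun t : ℝ => f t.toNNReal ω) 2
    (volume.restrict (Set.Icc (a : ℝ) (b : ℝ)))) ∧
  ∃ H : ℕ → ItoSimpleProcess 𝓕 a b,
    (∀ ε : ℝ≥0∞, 0 < ε →
      Tendsto (fun n => P {ω | ε ≤ ∫⁻ t in Set.Icc (a : ℝ) (b : ℝ),
        ‖(H n).val t.toNNReal ω - f t.toNNReal ω‖ₑ ^ 2}) atTop (𝓝 0)) ∧
    TendstoInMeasure P (fun n => (H n).integral W) atTop I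

end

/-! The engine is a discrete martingale transform `∑ Y_j Z_j`, where `Z_j` is centred and
independent of a past with respect to which `Y_j` is measurable. Orthogonality bounds its second
moment by its bracket `∑ Y_j² v_j`. Stopping the sum when the bracket exceeds a level turns this
into a bound in probability that asks for no moments of `Y_j`
(`IsCentredNoise.measure_transform_le`), so `Φ` and `Φ'` may grow arbitrarily. Brackets are shown to
vanish pathwise, by uniform continuity of paths on `[a, b]`; since `diamToZero` is countably
generated, almost sure convergence along it gives convergence in probability.

With centred squared increments as noise, `∑ ψ(W_{t_{j-1}}) (W_{t_j^*} - W_{t_{j-1}})²` tends to `λ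
∫ ψ(W) dt`. With the increments after `t_j^*` as noise, the cross terms `∑ ψ(W_{t_{j-1}}) (W_{t_j^*}
- W_{t_{j-1}}) (W_{t_j} - W_{t_j^*})` tend to `0`. Taylor expansion of an antiderivative of `Φ` and
the case `λ = 1` then give the limit `itoLimit` of the left-point sums. The Fehlberg sum minus the
left-point sum is linearised in `Φ`, and the increment is split at `t_j^*`: the square contributes
`λ ∫ Φ'(W) dt`, the cross term nothing.

It remains to see that every admissible sequence of simple processes has integrals tending to the
same `itoLimit`. Refining the partition of `H_n` leaves its integral unchanged, and on a fine
refinement its difference from the left-point sum is a transform whose bracket is at most `2 ∫ |H_n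
- Φ(W)|² dt` plus a vanishing oscillation term (`Refines.sum_sq_le`). -/

/-! ### Convergence in probability along countably generated filters. -/

section ConvergenceInMeasure

variable {Ω : Type*} {mΩ : MeasurableSpace Ω} {P : Measure Ω} {ι : Type*} {l : Filter ι}

lemma tendstoInMeasure_add {f g : ι → Ω → ℝ} {f' g' : Ω → ℝ} (hf : TendstoInMeasure P f l f')
    (hg : TendstoInMeasure P g l g') :
    TendstoInMeasure P (fun i ω => f i ω + g i ω) l (fun ω => f' ω + g' ω) := by
  intro ε hε
  have h2 : (0 : ℝ≥0∞) < ε / 2 := ENNReal.half_pos hε.ne'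
  have h := (hf _ h2).add (hg _ h2)
  rw [add_zero] at h
  refine tendsto_of_tendsto_of_tendsto_of_le_of_le tendsto_const_nhds h (fun _ => zero_le)
    fun i => ?_
  refine (measure_mono fun ω hω => ?_).trans (measure_union_le _ _)
  by_contra hc
  simp only [Set.mem_union, Set.mem_ofPred_eq, not_or, not_le] at hc hω
  refine absurd (hω.trans (edist_add_add_le _ _ _ _)) (not_le.2 ?_)
  exact (ENNReal.add_lt_add hc.1 hc.2).trans_le (ENNReal.add_halves ε).le

lemma tendstoInMeasure_const_mul {f : ι → Ω → ℝ} {f' : Ω → ℝ} (c : ℝ)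
    (hf : TendstoInMeasure P f l f') :
    TendstoInMeasure P (fun i ω => c * f i ω) l (fun ω => c * f' ω) := by
  rw [tendstoInMeasure_iff_dist] at hf ⊢
  intro ε hε
  have hc : 0 < |c| + 1 := by positivity
  refine tendsto_of_tendsto_of_tendsto_of_le_of_le tendsto_const_nhds (hf (ε / (|c| + 1))
    (by positivity)) (fun _ => zero_le) fun i => measure_mono fun ω hω => ?_
  simp only [Set.mem_ofPred_eq, Real.dist_eq, ← mul_sub, abs_mul] at hω ⊢
  rw [div_le_iff₀ hc]
  nlinarith [abs_nonneg (f i ω - f' ω)]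

/-- If `Q` converges in measure and `R` converges almost surely along every sequence along which
`Q` does, then `R` converges in measure. -/
lemma tendstoInMeasure_of_controlled [IsFiniteMeasure P] [l.IsCountablyGenerated]
    {R Q : ι → Ω → ℝ} {r q : Ω → ℝ} (hQ : TendstoInMeasure P Q l q)
    (hR : ∀ i, AEStronglyMeasurable (R i) P)
    (h : ∀ᵐ ω ∂P, ∀ u : ℕ → ι, Tendsto u atTop l →
      Tendsto (fun n => Q (u n) ω) atTop (𝓝 (q ω)) →
      Tendsto (fun n => R (u n) ω) atTop (𝓝 (r ω))) :
    TendstoInMeasure P R l r := by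
  intro ε hε
  refine tendsto_of_seq_tendsto fun u hu => ?_
  have key : TendstoInMeasure P (fun n => R (u n)) atTop r := by
    -- Subsequence criterion. In `h` the exceptional null set is chosen before the sequence, so it
    -- serves whichever subsequence makes `Q` converge almost everywhere.
    rw [exists_seq_tendstoInMeasure_atTop_iff fun n => hR (u n)]
    intro ns hns
    obtain ⟨ns', h1, h2⟩ := (hQ.comp (hu.comp hns.tendsto_atTop)).exists_seq_tendsto_ae
    refine ⟨ns', h1, ?_⟩
    filter_upwards [h, h2] with ω h3 h4
    exact h3 (fun i => u (ns (ns' i))) (hu.comp (hns.tendsto_atTop.comp h1.tendsto_atTop)) h4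
  exact key ε hε

lemma tendstoInMeasure_of_tendsto_ae_filter [IsFiniteMeasure P] [l.IsCountablyGenerated]
    {R : ι → Ω → ℝ} {r : Ω → ℝ} (hR : ∀ i, AEStronglyMeasurable (R i) P)
    (h : ∀ᵐ ω ∂P, Tendsto (fun i => R i ω) l (𝓝 (r ω))) :
    TendstoInMeasure P R l r := by
  refine tendstoInMeasure_of_controlled (Q := fun _ _ => 0) (q := fun _ => 0) ?_ hR ?_
  · intro ε hε
    simpa [hε.ne'] using tendsto_const_nhds
  · filter_upwards [h] with ω hω u hu _
    exact hω.comp hu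

end ConvergenceInMeasure

lemma Fin.sum_succ_sub_castSucc {n : ℕ} (f : Fin (n + 1) → ℝ) :
    ∑ j : Fin n, (f j.succ - f j.castSucc) = f (Fin.last n) - f 0 := by
  induction n with
  | zero => simp
  | succ n ih =>
    rw [Fin.sum_univ_castSucc, Fin.succ_last]
    have h := ih (fun i => f i.castSucc)
    simp only [Fin.castSucc_zero, ← Fin.succ_castSucc] at h
    rw [h]
    ring

/-! ### Partitions: Riemann sums, refinements, step functions. -/

namespace TimePartition

variable {a b : ℝ≥0} (π : TimePartition a b)

lemma pt_lt (j : Fin π.n) : π.pt j.castSucc < π.pt j.succ :=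
  π.strictMono Fin.castSucc_lt_succ

lemma pt_le (j : Fin π.n) : π.pt j.castSucc ≤ π.pt j.succ := (π.pt_lt j).le

lemma le_pt (i : Fin (π.n + 1)) : a ≤ π.pt i := by
  exact π.first.symm.trans_le (π.strictMono.monotone (Fin.zero_le i))

lemma pt_le_last (i : Fin (π.n + 1)) : π.pt i ≤ b := by
  exact (π.strictMono.monotone (Fin.le_last i)).trans_eq π.last

lemma le_of_partition (π : TimePartition a b) : a ≤ b := (π.le_pt 0).trans (π.pt_le_last 0)

lemma succ_le_castSucc {i j : Fin π.n} (h : i < j) : π.pt i.succ ≤ π.pt j.castSucc :=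
  π.strictMono.monotone (Fin.succ_le_castSucc_iff.2 h)

lemma sub_le_diam (j : Fin π.n) : π.pt j.succ - π.pt j.castSucc ≤ π.diam :=
  Finset.le_sup (f := fun j : Fin π.n => π.pt j.succ - π.pt j.castSucc) (Finset.mem_univ j)

lemma coe_sub_le_diam (j : Fin π.n) : (π.pt j.succ : ℝ) - π.pt j.castSucc ≤ π.diam := by
  rw [← NNReal.coe_sub (π.pt_le j)]
  exact_mod_cast π.sub_le_diam j

lemma length_nonneg (j : Fin π.n) : 0 ≤ (π.pt j.succ : ℝ) - π.pt j.castSucc :=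
  sub_nonneg.2 (by exact_mod_cast π.pt_le j)

lemma sum_length : ∑ j : Fin π.n, ((π.pt j.succ : ℝ) - π.pt j.castSucc) = b - a := by
  rw [Fin.sum_succ_sub_castSucc (fun i => (π.pt i : ℝ)), π.first, π.last]

/-- Allows limits over all partitions to be tested on sequences of partitions. -/
instance : (diamToZero a b).IsCountablyGenerated := by unfold diamToZero; infer_instance

lemma eventually_diam_le {δ : ℝ≥0} (hδ : 0 < δ) :
    ∀ᶠ π : TimePartition a b in diamToZero a b, π.diam ≤ δ :=
  tendsto_comap.eventually (eventually_le_nhds hδ)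

lemma tendsto_diam :
    Tendsto (fun π : TimePartition a b => (π.diam : ℝ)) (diamToZero a b) (𝓝 0) :=
  NNReal.tendsto_coe.2 tendsto_comap

/-- The point `lam * t_j + (1 - lam) * t_{j-1}` of the subinterval `[t_{j-1}, t_j]`. -/
noncomputable def tag (lam : ℝ≥0) (j : Fin π.n) : ℝ≥0 :=
  lam * π.pt j.succ + (1 - lam) * π.pt j.castSucc

lemma coe_tag {lam : ℝ≥0} (hl : lam ≤ 1) (j : Fin π.n) :
    (π.tag lam j : ℝ) = π.pt j.castSucc + lam * (π.pt j.succ - π.pt j.castSucc) := by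
  simp only [tag, NNReal.coe_add, NNReal.coe_mul, NNReal.coe_sub hl, NNReal.coe_one]
  ring

/-- At `lam = 0` the final part of a subinterval, and at `lam = 1` its initial part, is the whole of
it; results for general tags thus also cover full increments. -/
lemma tag_zero (j : Fin π.n) : π.tag 0 j = π.pt j.castSucc := by simp [tag]

lemma tag_one (j : Fin π.n) : π.tag 1 j = π.pt j.succ := by simp [tag]

lemma le_tag {lam : ℝ≥0} (hl : lam ≤ 1) (j : Fin π.n) : π.pt j.castSucc ≤ π.tag lam j := by
  rw [← NNReal.coe_le_coe, π.coe_tag hl]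
  have := mul_nonneg lam.coe_nonneg (π.length_nonneg j)
  linarith

lemma tag_le {lam : ℝ≥0} (hl : lam ≤ 1) (j : Fin π.n) : π.tag lam j ≤ π.pt j.succ := by
  rw [← NNReal.coe_le_coe, π.coe_tag hl]
  have h : (lam : ℝ) ≤ 1 := by exact_mod_cast hl
  nlinarith [π.length_nonneg j]

/-- A continuous path oscillates uniformly little on the subintervals of fine partitions. -/
lemma eventually_osc_le {x : ℝ≥0 → ℝ} (hx : Continuous x) {η : ℝ} (hη : 0 < η) :
    ∀ᶠ π : TimePartition a b in diamToZero a b, ∀ j : Fin π.n,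
      ∀ s ∈ Set.Icc (π.pt j.castSucc) (π.pt j.succ),
      ∀ t ∈ Set.Icc (π.pt j.castSucc) (π.pt j.succ), |x s - x t| ≤ η := by
  have hu : UniformContinuousOn x (Set.Icc a b) :=
    isCompact_Icc.uniformContinuousOn_of_continuous hx.continuousOn
  rw [Metric.uniformContinuousOn_iff] at hu
  obtain ⟨δ, hδ, hu⟩ := hu η hη
  have h2 : 0 < (δ / 2).toNNReal := Real.toNNReal_pos.2 (by positivity)
  filter_upwards [eventually_diam_le h2] with π hπ j s hs t ht
  have hsub : Set.Icc (π.pt j.castSucc) (π.pt j.succ) ⊆ Set.Icc a b :=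
    Set.Icc_subset_Icc (π.le_pt _) (π.pt_le_last _)
  have h3 : (π.diam : ℝ) ≤ δ / 2 := (Real.le_toNNReal_iff_coe_le (by positivity)).1 hπ
  have h4 := π.coe_sub_le_diam j
  have hs1 : (π.pt j.castSucc : ℝ) ≤ s := by exact_mod_cast hs.1
  have hs2 : (s : ℝ) ≤ π.pt j.succ := by exact_mod_cast hs.2
  have ht1 : (π.pt j.castSucc : ℝ) ≤ t := by exact_mod_cast ht.1
  have ht2 : (t : ℝ) ≤ π.pt j.succ := by exact_mod_cast ht.2
  refine (hu s (hsub hs) t (hsub ht) ?_).le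
  rw [NNReal.dist_eq, abs_lt]
  constructor <;> linarith

/-- Left Riemann sums of a continuous path converge to its integral. -/
lemma tendsto_riemannSum {h : ℝ≥0 → ℝ} (hh : Continuous h) :
    Tendsto (fun π : TimePartition a b => ∑ j : Fin π.n,
      h (π.pt j.castSucc) * ((π.pt j.succ : ℝ) - π.pt j.castSucc)) (diamToZero a b)
      (𝓝 (∫ t in (a : ℝ)..b, h t.toNNReal)) := by
  have hc : Continuous fun t : ℝ => h t.toNNReal := hh.comp continuous_real_toNNReal
  rw [Metric.tendsto_nhds]
  intro ε hε
  by_cases hab : (a : ℝ≥0) ≤ b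
  swap
  · refine Eventually.of_forall fun π => absurd π.le_of_partition hab
  have hba : (0 : ℝ) ≤ b - a := sub_nonneg.2 (by exact_mod_cast hab)
  -- The total error is at most `η * (b - a)`; the added `1` gives strict inequality and covers `a =
  -- b`.
  set η := ε / (b - a + 1)
  have hη : 0 < η := by positivity
  filter_upwards [eventually_osc_le hh hη] with π hπ
  have h1 : ∫ t in (a : ℝ)..b, h t.toNNReal =
      ∑ j : Fin π.n, ∫ t in (π.pt j.castSucc : ℝ)..π.pt j.succ, h t.toNNReal := by
    have := Fin.sum_succ_sub_castSucc (fun i => ∫ t in (a : ℝ)..π.pt i, h t.toNNReal)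
    simp only [π.first, π.last, intervalIntegral.integral_same, sub_zero] at this
    rw [← this]
    refine Finset.sum_congr rfl fun j _ => ?_
    exact intervalIntegral.integral_interval_sub_left (hc.intervalIntegrable _ _)
      (hc.intervalIntegrable _ _)
  have h2 : ∀ j : Fin π.n, |h (π.pt j.castSucc) * ((π.pt j.succ : ℝ) - π.pt j.castSucc) -
      ∫ t in (π.pt j.castSucc : ℝ)..π.pt j.succ, h t.toNNReal| ≤
      η * ((π.pt j.succ : ℝ) - π.pt j.castSucc) := by
    intro j
    have e : h (π.pt j.castSucc) * ((π.pt j.succ : ℝ) - π.pt j.castSucc) =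
        ∫ _ in (π.pt j.castSucc : ℝ)..π.pt j.succ, h (π.pt j.castSucc) := by
      simp [mul_comm]
    have hle : (π.pt j.castSucc : ℝ) ≤ π.pt j.succ := by exact_mod_cast π.pt_le j
    rw [e, ← intervalIntegral.integral_sub (by simp) (hc.intervalIntegrable _ _)]
    rw [← Real.norm_eq_abs]
    refine (intervalIntegral.norm_integral_le_of_norm_le_const (C := η) fun t ht => ?_).trans
      (by rw [abs_of_nonneg (π.length_nonneg j)])
    rw [Set.uIoc_of_le hle] at ht
    refine hπ j _ ⟨le_rfl, π.pt_le j⟩ _ ⟨?_, ?_⟩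
    · exact NNReal.le_toNNReal_of_coe_le ht.1.le
    · exact Real.toNNReal_le_iff_le_coe.2 ht.2
  rw [Real.dist_eq, h1, ← Finset.sum_sub_distrib]
  calc _ ≤ ∑ j : Fin π.n, η * ((π.pt j.succ : ℝ) - π.pt j.castSucc) :=
        (Finset.abs_sum_le_sum_abs _ _).trans (Finset.sum_le_sum fun j _ => h2 j)
    _ = η * (b - a) := by rw [← Finset.mul_sum, π.sum_length]
    _ < ε := by
      rw [div_mul_eq_mul_div, div_lt_iff₀ (by positivity)]
      nlinarith

/-- `π'` refines `π`: no point of `π` is interior to a subinterval of `π'`. -/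
def Refines (π' π : TimePartition a b) : Prop :=
  ∀ (i : Fin (π.n + 1)) (k : Fin π'.n), π.pt i ≤ π'.pt k.castSucc ∨ π'.pt k.succ ≤ π.pt i

/-- There is a partition of `[a, b]` through any finite set of points with given mesh. -/
lemma exists_partition (hab : a < b) (T : Finset ℝ≥0) (hT : ∀ t ∈ T, t ∈ Set.Icc a b)
    {δ : ℝ≥0} (hδ : 0 < δ) : ∃ π : TimePartition a b, π.diam ≤ δ ∧
      ∀ t ∈ T, ∀ k : Fin π.n, t ≤ π.pt k.castSucc ∨ π.pt k.succ ≤ t := by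
  classical
  -- The grid `a + k δ` needs indices up to `⌊(s - a) / δ⌋ + 1` for `s ≤ b`, which `+ 2` puts inside
  -- `range N`.
  set N := ⌈(b - a) / δ⌉₊ + 2
  set S : Finset ℝ≥0 := insert a (insert b (T ∪
    ((Finset.range N).image fun k : ℕ => a + k * δ).filter (· ≤ b)))
  have hS : ∀ t ∈ S, t ∈ Set.Icc a b := by
    intro t ht
    simp only [S, Finset.mem_insert, Finset.mem_union, Finset.mem_filter, Finset.mem_image] at ht
    rcases ht with rfl | rfl | ht | ⟨⟨k, -, rfl⟩, h⟩
    · exact ⟨le_rfl, hab.le⟩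
    · exact ⟨hab.le, le_rfl⟩
    · exact hT t ht
    · exact ⟨by simp, h⟩
  have haS : a ∈ S := by simp [S]
  have hbS : b ∈ S := by simp [S]
  obtain ⟨n, hn⟩ : ∃ n, S.card = n + 1 :=
    ⟨S.card - 1, (Nat.succ_pred_eq_of_pos (Finset.card_pos.2 ⟨a, haS⟩)).symm⟩
  have hmem : ∀ i, S.orderEmbOfFin hn i ∈ S := Finset.orderEmbOfFin_mem S hn
  have hsurj : ∀ t ∈ S, ∃ i, S.orderEmbOfFin hn i = t := by
    intro t ht
    have := Finset.range_orderEmbOfFin S hn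
    exact (Set.ext_iff.1 this t).2 (Finset.mem_coe.2 ht)
  have hmono : StrictMono (S.orderEmbOfFin hn) := (S.orderEmbOfFin hn).strictMono
  have hgap : ∀ t ∈ S, ∀ k : Fin n, t ≤ S.orderEmbOfFin hn k.castSucc ∨
      S.orderEmbOfFin hn k.succ ≤ t := by
    intro t ht k
    obtain ⟨i, rfl⟩ := hsurj t ht
    rcases le_or_gt i k.castSucc with h | h
    · exact Or.inl (hmono.monotone h)
    · exact Or.inr (hmono.monotone (Fin.castSucc_lt_iff_succ_le.1 h))
  refine ⟨⟨n, S.orderEmbOfFin hn, hmono, ?_, ?_⟩, ?_, ?_⟩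
  · obtain ⟨i, hi⟩ := hsurj a haS
    exact le_antisymm (hi ▸ hmono.monotone (Fin.zero_le i)) (hS _ (hmem _)).1
  · obtain ⟨i, hi⟩ := hsurj b hbS
    refine le_antisymm (hS _ (hmem _)).2 ?_
    conv_lhs => rw [← hi]
    exact hmono.monotone (Fin.le_last i)
  · refine Finset.sup_le fun k _ => ?_
    simp only
    set s := S.orderEmbOfFin hn k.castSucc with hs
    set t := S.orderEmbOfFin hn k.succ with ht
    by_contra hlt
    rw [not_le] at hlt
    have hsI := hS s (hmem _)
    have htI := hS t (hmem _)
    -- Index of the first grid point beyond `s`. It satisfies `s < a + m δ ≤ s + δ < t`, so it would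
    -- lie strictly between the consecutive points `s` and `t`.
    set m := ⌊(s - a) / δ⌋₊ + 1
    have hδ' : (0 : ℝ) < δ := by exact_mod_cast hδ
    have hst : (δ : ℝ) < t - s := by
      have : s + δ < t := by
        rw [lt_tsub_iff_left] at hlt; exact hlt
      have : ((s + δ : ℝ≥0) : ℝ) < t := by exact_mod_cast this
      push_cast at this; linarith
    have hsa : ((s - a : ℝ≥0) : ℝ) = s - a := NNReal.coe_sub hsI.1
    have h1 : ((s : ℝ) - a) < m * δ := by
      have := Nat.lt_floor_add_one ((s - a) / δ)
      have : (((s - a) / δ : ℝ≥0) : ℝ) < m := by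
        simp only [m]; exact_mod_cast this
      rwa [NNReal.coe_div, hsa, div_lt_iff₀ hδ'] at this
    have h2 : m * (δ : ℝ) ≤ s - a + δ := by
      have := Nat.floor_le (zero_le (a := (s - a) / δ))
      have : ((⌊(s - a) / δ⌋₊ : ℝ≥0) : ℝ) ≤ ((s - a) / δ : ℝ≥0) := by exact_mod_cast this
      rw [NNReal.coe_div, hsa, le_div_iff₀ hδ'] at this
      simp only [m]; push_cast at this ⊢; linarith
    have hlt_t : a + m * δ < t := by
      rw [← NNReal.coe_lt_coe]; push_cast; linarith
    have hgt_s : s < a + m * δ := by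
      rw [← NNReal.coe_lt_coe]; push_cast; linarith
    have hmS : a + m * δ ∈ S := by
      simp only [S, Finset.mem_insert, Finset.mem_union, Finset.mem_filter, Finset.mem_image]
      refine Or.inr (Or.inr (Or.inr ⟨⟨m, ?_, rfl⟩, hlt_t.le.trans htI.2⟩))
      rw [Finset.mem_range]
      have : ⌊(s - a) / δ⌋₊ ≤ ⌈(b - a) / δ⌉₊ := by
        refine (Nat.floor_le_ceil _).trans (Nat.ceil_mono ?_)
        gcongr; exact hsI.2
      omega
    rcases hgap _ hmS k with h | h
    · exact absurd h (not_le.2 hgt_s)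
    · exact absurd h (not_le.2 hlt_t)
  · intro t ht k
    exact hgap t (by simp [S, ht]) k

lemma exists_refinement (hab : a < b) (π : TimePartition a b) {δ : ℝ≥0} (hδ : 0 < δ) :
    ∃ π' : TimePartition a b, π'.diam ≤ δ ∧ π'.Refines π := by
  classical
  obtain ⟨π', h1, h2⟩ := exists_partition hab (Finset.univ.image π.pt) (by
    intro t ht
    obtain ⟨i, -, rfl⟩ := Finset.mem_image.1 ht
    exact ⟨π.le_pt i, π.pt_le_last i⟩) hδ
  exact ⟨π', h1, fun i k => h2 _ (Finset.mem_image_of_mem _ (Finset.mem_univ i)) k⟩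

lemma tendsto_diamToZero_of_diam_le {u : ℕ → TimePartition a b}
    (hu : ∀ n, (u n).diam ≤ 1 / (n + 1)) : Tendsto u atTop (diamToZero a b) := by
  refine tendsto_comap_iff.2 ?_
  have h : Tendsto (fun n : ℕ => (1 : ℝ≥0) / (n + 1)) atTop (𝓝 0) := by
    rw [← NNReal.tendsto_coe]
    simpa using tendsto_one_div_add_atTop_nhds_zero_nat (𝕜 := ℝ)
  exact tendsto_of_tendsto_of_tendsto_of_le_of_le tendsto_const_nhds h (fun _ => zero_le) hu

lemma exists_seq_tendsto_diamToZero (hab : a < b) :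
    ∃ u : ℕ → TimePartition a b, Tendsto u atTop (diamToZero a b) := by
  have h : ∀ n : ℕ, ∃ π : TimePartition a b, π.diam ≤ 1 / (n + 1) := fun n =>
    (exists_partition hab ∅ (by simp) (by positivity)).imp fun _ h => h.1
  choose u hu using h
  exact ⟨u, tendsto_diamToZero_of_diam_le hu⟩

/-- Limits in measure are almost everywhere unique only along a nontrivial filter; this serves the
uniqueness of the Fehlberg integral. -/
lemma diamToZero_neBot (hab : a < b) : (diamToZero a b).NeBot := by
  obtain ⟨u, hu⟩ := exists_seq_tendsto_diamToZero hab
  exact hu.neBot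

/-- The step function with value `c j` on `(t_{j-1}, t_j]`. -/
noncomputable def stepFun (c : Fin π.n → ℝ) (t : ℝ≥0) : ℝ :=
  ∑ j : Fin π.n, (Set.Ioc (π.pt j.castSucc) (π.pt j.succ)).indicator (fun _ => c j) t

lemma stepFun_of_mem (c : Fin π.n → ℝ) {j : Fin π.n} {t : ℝ≥0}
    (ht : t ∈ Set.Ioc (π.pt j.castSucc) (π.pt j.succ)) : π.stepFun c t = c j := by
  rw [stepFun, Finset.sum_eq_single j]
  · simp [ht]
  · intro i _ hij
    refine Set.indicator_of_notMem (fun hi => ?_) _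
    rcases lt_or_gt_of_ne hij with h | h
    · exact absurd (ht.1.trans_le (hi.2.trans (π.succ_le_castSucc h))) (lt_irrefl _)
    · exact absurd (hi.1.trans_le (ht.2.trans (π.succ_le_castSucc h))) (lt_irrefl _)
  · simp

lemma exists_mem_Ioc {t : ℝ≥0} (ht : t ∈ Set.Ioc a b) :
    ∃ j : Fin π.n, t ∈ Set.Ioc (π.pt j.castSucc) (π.pt j.succ) := by
  by_contra! h
  have : ∀ i, π.pt i < t := by
    intro i
    induction i using Fin.induction with
    | zero => rw [π.first]; exact ht.1
    | succ i ih => exact not_le.1 fun hle => h i ⟨ih, hle⟩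
  exact absurd ht.2 (not_le.2 (π.last ▸ this (Fin.last _)))

/-- A cell of the finer partition has no point of the coarser one in its interior, so it lies inside
a given coarse cell or misses it; hence the criterion does not involve `t`. -/
lemma Refines.mem_Ioc_iff {π' π : TimePartition a b} (h : π'.Refines π) (j : Fin π.n)
    (k : Fin π'.n) {t : ℝ≥0} (ht : t ∈ Set.Ioc (π'.pt k.castSucc) (π'.pt k.succ)) :
    t ∈ Set.Ioc (π.pt j.castSucc) (π.pt j.succ) ↔
      π.pt j.castSucc ≤ π'.pt k.castSucc ∧ π'.pt k.succ ≤ π.pt j.succ := by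
  constructor
  · intro hj
    refine ⟨(h j.castSucc k).resolve_right fun h' => ?_, (h j.succ k).resolve_left fun h' => ?_⟩
    · exact absurd (hj.1.trans_le (ht.2.trans h')) (lt_irrefl _)
    · exact absurd (ht.1.trans_le (hj.2.trans h')) (lt_irrefl _)
  · rintro ⟨h1, h2⟩
    exact ⟨h1.trans_lt ht.1, ht.2.trans h2⟩

lemma right_mem_Ioc (k : Fin π.n) :
    π.pt k.succ ∈ Set.Ioc (π.pt k.castSucc) (π.pt k.succ) := ⟨π.pt_lt k, le_rfl⟩

lemma Refines.stepFun_eq {π' π : TimePartition a b} (h : π'.Refines π) (c : Fin π.n → ℝ)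
    (k : Fin π'.n) {t : ℝ≥0} (ht : t ∈ Set.Ioc (π'.pt k.castSucc) (π'.pt k.succ)) :
    π.stepFun c t = π.stepFun c (π'.pt k.succ) := by
  refine Finset.sum_congr rfl fun j _ => ?_
  simp only [Set.indicator, h.mem_Ioc_iff j k ht, h.mem_Ioc_iff j k (π'.right_mem_Ioc k)]

/-- The integral of a step function does not change under refinement. -/
lemma Refines.sum_eq {π' π : TimePartition a b} (h : π'.Refines π) (c : Fin π.n → ℝ)
    (x : ℝ≥0 → ℝ) :
    ∑ k : Fin π'.n, π.stepFun c (π'.pt k.succ) * (x (π'.pt k.succ) - x (π'.pt k.castSucc)) =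
      ∑ j : Fin π.n, c j * (x (π.pt j.succ) - x (π.pt j.castSucc)) := by
  simp only [stepFun, Finset.sum_mul]
  rw [Finset.sum_comm]
  refine Finset.sum_congr rfl fun j _ => ?_
  set p := π.pt j.castSucc
  set q := π.pt j.succ
  have hpq : p ≤ q := π.pt_le j
  -- Clamp the fine points to `[p, q]` and telescope: fine cells inside `(p, q]` keep their
  -- increment, all others collapse to zero.
  have key := Fin.sum_succ_sub_castSucc (fun i => x (max p (min (π'.pt i) q)))
  rw [π'.first, π'.last, min_eq_right (π.pt_le_last _), max_eq_right hpq,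
    max_eq_left ((min_le_left _ _).trans (π.le_pt _))] at key
  rw [← key, Finset.mul_sum]
  refine Finset.sum_congr rfl fun k _ => ?_
  have hk := π'.pt_le k
  by_cases hm : π'.pt k.succ ∈ Set.Ioc p q
  · have h2 := (h.mem_Ioc_iff j k (π'.right_mem_Ioc k)).1 hm
    rw [Set.indicator_of_mem hm, min_eq_left h2.2, min_eq_left (hk.trans h2.2),
      max_eq_right h2.1, max_eq_right (h2.1.trans hk)]
  · rw [Set.indicator_of_notMem hm, zero_mul]
    have : max p (min (π'.pt k.succ) q) = max p (min (π'.pt k.castSucc) q) := by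
      rcases h j.castSucc k with h1 | h1
      · rcases h j.succ k with h2 | h2
        · rw [min_eq_right h2, min_eq_right (h2.trans hk)]
        · exact absurd ⟨h1.trans_lt (π'.pt_lt k), h2⟩ hm
      · rw [max_eq_left ((min_le_left _ _).trans h1),
          max_eq_left ((min_le_left _ _).trans (hk.trans h1))]
    rw [this, sub_self, mul_zero]

/-- The bound is asked for on `Ioc` only, since step functions vanish at `a`; that point is a null
set. -/
lemma lintegral_sq_le {g : ℝ≥0 → ℝ} {η : ℝ}
    (h : ∀ t ∈ Set.Ioc a b, |g t| ≤ η) :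
    ∫⁻ t in Set.Icc (a : ℝ) b, ‖g t.toNNReal‖ₑ ^ 2 ≤ ENNReal.ofReal (η ^ 2 * (b - a)) := by
  rw [setLIntegral_congr Ioc_ae_eq_Icc.symm]
  calc _ ≤ ∫⁻ _ in Set.Ioc (a : ℝ) b, ENNReal.ofReal (η ^ 2) := by
        refine setLIntegral_mono measurable_const fun t ht => ?_
        have h1 : t.toNNReal ∈ Set.Ioc a b :=
          ⟨by rw [Real.lt_toNNReal_iff_coe_lt]; exact ht.1, Real.toNNReal_le_iff_le_coe.2 ht.2⟩
        have h2 := h _ h1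
        rw [Real.enorm_eq_ofReal_abs, ← ENNReal.ofReal_pow (abs_nonneg _)]
        exact ENNReal.ofReal_le_ofReal (pow_le_pow_left₀ (abs_nonneg _) h2 2)
    _ = _ := by
      rw [setLIntegral_const, Real.volume_Ioc, ← ENNReal.ofReal_mul (sq_nonneg _)]

/-- Comparison of the step function of `π` with the left-point step function of a refinement. -/
lemma Refines.sum_sq_le {π' π : TimePartition a b} (h : π'.Refines π) (c : Fin π.n → ℝ)
    (y : ℝ≥0 → ℝ) {η : ℝ} (hη : ∀ k : Fin π'.n,
      ∀ t ∈ Set.Icc (π'.pt k.castSucc) (π'.pt k.succ), |y t - y (π'.pt k.castSucc)| ≤ η) :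
    ENNReal.ofReal (∑ k : Fin π'.n, (π.stepFun c (π'.pt k.succ) - y (π'.pt k.castSucc)) ^ 2 *
      ((π'.pt k.succ : ℝ) - π'.pt k.castSucc)) ≤
    2 * (∫⁻ t in Set.Icc (a : ℝ) b, ‖π.stepFun c t.toNNReal - y t.toNNReal‖ₑ ^ 2) +
      2 * ENNReal.ofReal (η ^ 2 * (b - a)) := by
  set d : Fin π'.n → ℝ := fun k => π.stepFun c (π'.pt k.succ) - y (π'.pt k.castSucc)
  have hdisj : Pairwise (Function.onFun Disjoint
      fun k : Fin π'.n => Set.Ioc (π'.pt k.castSucc : ℝ) (π'.pt k.succ)) := by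
    intro i k hik
    rw [Function.onFun, Set.disjoint_left]
    intro t hi hk
    rcases lt_or_gt_of_ne hik with h' | h'
    · have : (π'.pt i.succ : ℝ) ≤ π'.pt k.castSucc := by exact_mod_cast π'.succ_le_castSucc h'
      linarith [hi.2, hk.1]
    · have : (π'.pt k.succ : ℝ) ≤ π'.pt i.castSucc := by exact_mod_cast π'.succ_le_castSucc h'
      linarith [hk.2, hi.1]
  have hpt : ∀ k : Fin π'.n, ∀ t ∈ Set.Ioc (π'.pt k.castSucc : ℝ) (π'.pt k.succ),
      ENNReal.ofReal (d k ^ 2) ≤ 2 * ‖π.stepFun c t.toNNReal - y t.toNNReal‖ₑ ^ 2 +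
        2 * ENNReal.ofReal (η ^ 2) := by
    intro k t ht
    have h1 : t.toNNReal ∈ Set.Ioc (π'.pt k.castSucc) (π'.pt k.succ) :=
      ⟨by rw [Real.lt_toNNReal_iff_coe_lt]; exact ht.1, Real.toNNReal_le_iff_le_coe.2 ht.2⟩
    have h2 := hη k _ (Set.Ioc_subset_Icc_self h1)
    have h3 := h.stepFun_eq c k h1
    set u := π.stepFun c t.toNNReal - y t.toNNReal
    -- The factors `2` come from `(u + w)² ≤ 2 u² + 2 w²`, with `w` the oscillation of `y` on the
    -- fine cell.
    have hd : d k = u + (y t.toNNReal - y (π'.pt k.castSucc)) := by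
      simp only [d, u, h3]; ring
    have h4 : (y t.toNNReal - y (π'.pt k.castSucc)) ^ 2 ≤ η ^ 2 := sq_le_sq' (abs_le.1 h2).1 (abs_le.1 h2).2
    rw [Real.enorm_eq_ofReal_abs, ← ENNReal.ofReal_pow (abs_nonneg _), sq_abs,
      ← ENNReal.ofReal_ofNat 2, ← ENNReal.ofReal_mul (by norm_num),
      ← ENNReal.ofReal_mul (by norm_num), ← ENNReal.ofReal_add (by positivity) (by positivity)]
    refine ENNReal.ofReal_le_ofReal ?_
    rw [hd]
    nlinarith [sq_nonneg (u - (y t.toNNReal - y (π'.pt k.castSucc)))]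
  calc _ = ∑ k : Fin π'.n, ∫⁻ _ in Set.Ioc (π'.pt k.castSucc : ℝ) (π'.pt k.succ),
          ENNReal.ofReal (d k ^ 2) := by
        rw [ENNReal.ofReal_sum_of_nonneg fun k _ =>
          mul_nonneg (sq_nonneg _) (π'.length_nonneg k)]
        refine Finset.sum_congr rfl fun k _ => ?_
        rw [setLIntegral_const, Real.volume_Ioc, ← ENNReal.ofReal_mul (sq_nonneg _)]
    _ ≤ ∑ k : Fin π'.n, ∫⁻ t in Set.Ioc (π'.pt k.castSucc : ℝ) (π'.pt k.succ),
          (2 * ‖π.stepFun c t.toNNReal - y t.toNNReal‖ₑ ^ 2 + 2 * ENNReal.ofReal (η ^ 2)) :=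
        Finset.sum_le_sum fun k _ => setLIntegral_mono' measurableSet_Ioc (hpt k)
    _ = ∫⁻ t in ⋃ k : Fin π'.n, Set.Ioc (π'.pt k.castSucc : ℝ) (π'.pt k.succ),
          (2 * ‖π.stepFun c t.toNNReal - y t.toNNReal‖ₑ ^ 2 + 2 * ENNReal.ofReal (η ^ 2)) := by
        rw [lintegral_iUnion (fun _ => measurableSet_Ioc) hdisj, tsum_fintype]
    _ ≤ ∫⁻ t in Set.Icc (a : ℝ) b,
          (2 * ‖π.stepFun c t.toNNReal - y t.toNNReal‖ₑ ^ 2 + 2 * ENNReal.ofReal (η ^ 2)) := by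
        refine lintegral_mono_set (Set.iUnion_subset fun k => Set.Ioc_subset_Icc_self.trans
          (Set.Icc_subset_Icc ?_ ?_))
        · exact_mod_cast π'.le_pt _
        · exact_mod_cast π'.pt_le_last _
    _ = _ := by
        rw [lintegral_add_right _ measurable_const, lintegral_const_mul' _ _ (by simp),
          setLIntegral_const, Real.volume_Icc, mul_assoc, ← ENNReal.ofReal_mul (sq_nonneg _)]

end TimePartition

/-! ### Discrete martingale transforms and their control by the bracket. -/

section MartingaleTransform

variable {Ω : Type*} {mΩ : MeasurableSpace Ω} {P : Measure Ω}

lemma Real.enorm_sq_eq_ofReal (x : ℝ) : ‖x‖ₑ ^ 2 = ENNReal.ofReal (x ^ 2) := by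
  rw [Real.enorm_eq_ofReal_abs, ← ENNReal.ofReal_pow (abs_nonneg _), sq_abs]

lemma memLp_two_of_lintegral_sq_ne_top {f : Ω → ℝ} (hf : AEStronglyMeasurable f P)
    (h : ∫⁻ ω, ‖f ω‖ₑ ^ 2 ∂P ≠ ∞) : MemLp f 2 P := by
  refine ⟨hf, ?_⟩
  rw [eLpNorm_lt_top_iff_lintegral_rpow_enorm_lt_top (by norm_num) (by norm_num)]
  simpa using h.lt_top

lemma lintegral_sq_eq_ofReal_integral {f : Ω → ℝ} (hf : MemLp f 2 P) :
    ∫⁻ ω, ‖f ω‖ₑ ^ 2 ∂P = ENNReal.ofReal (∫ ω, f ω ^ 2 ∂P) := by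
  rw [ofReal_integral_eq_lintegral_ofReal hf.integrable_sq
    (Eventually.of_forall fun _ => sq_nonneg _)]
  simp_rw [Real.enorm_sq_eq_ofReal]

lemma lintegral_sq_sum_of_orthogonal {ι : Type*} [Fintype ι] {D : ι → Ω → ℝ}
    (hD : ∀ j, MemLp (D j) 2 P) (h : ∀ i j, i ≠ j → ∫ ω, D i ω * D j ω ∂P = 0) :
    ∫⁻ ω, ‖∑ j, D j ω‖ₑ ^ 2 ∂P = ∑ j, ∫⁻ ω, ‖D j ω‖ₑ ^ 2 ∂P := by
  rw [lintegral_sq_eq_ofReal_integral (memLp_finsetSum _ fun j _ => hD j)]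
  simp_rw [lintegral_sq_eq_ofReal_integral (hD _)]
  rw [← ENNReal.ofReal_sum_of_nonneg fun j _ => integral_nonneg fun _ => sq_nonneg _]
  congr 1
  have hint : ∀ i j, Integrable (fun ω => D i ω * D j ω) P := fun i j =>
    (hD i).integrable_mul (hD j)
  simp_rw [sq, Finset.sum_mul_sum]
  rw [integral_finsetSum _ fun i _ => integrable_finsetSum _ fun j _ => hint i j]
  refine Finset.sum_congr rfl fun i _ => ?_
  rw [integral_finsetSum _ fun j _ => hint i j]
  exact Finset.sum_eq_single i (fun j _ hj => h i j hj.symm) (by simp)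

/-- Noise terms `Z j`, centred and independent of the past `m j`, which contains the earlier
noise terms. -/
structure IsCentredNoise (P : Measure Ω) {n : ℕ} (m : Fin n → MeasurableSpace Ω)
    (Z : Fin n → Ω → ℝ) (v : Fin n → ℝ) : Prop where
  le : ∀ j, m j ≤ mΩ
  mono : ∀ i j, i ≤ j → m i ≤ m j
  measurable : ∀ j, Measurable (Z j)
  measurable_past : ∀ i j, i < j → Measurable[m j] (Z i)
  indep : ∀ j, Indep (MeasurableSpace.comap (Z j) inferInstance) (m j) P
  integral_eq_zero : ∀ j, ∫ ω, Z j ω ∂P = 0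
  nonneg : ∀ j, 0 ≤ v j
  lintegral_sq_le : ∀ j, ∫⁻ ω, ‖Z j ω‖ₑ ^ 2 ∂P ≤ ENNReal.ofReal (v j)

variable {n : ℕ} {m : Fin n → MeasurableSpace Ω} {Z : Fin n → Ω → ℝ} {v : Fin n → ℝ}

lemma IsCentredNoise.indepFun (h : IsCentredNoise P m Z v) {j : Fin n} {X : Ω → ℝ}
    (hX : Measurable[m j] X) : IndepFun X (Z j) P :=
  (IndepFun_iff_Indep _ _ _).2 (indep_of_indep_of_le_left (h.indep j).symm hX.comap_le)

/-- By independence a diagonal term factors into at most `E[Y_j²] v_j`, and the cross terms vanish.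
Square integrability of each `Y_j Z_j` is not assumed: it follows from the sure bound on the
bracket. -/
lemma IsCentredNoise.lintegral_transform_le [IsProbabilityMeasure P] (h : IsCentredNoise P m Z v)
    {Y : Fin n → Ω → ℝ} (hY : ∀ j, Measurable[m j] (Y j)) {δ : ℝ}
    (hδ : ∀ ω, ∑ j, Y j ω ^ 2 * v j ≤ δ) :
    ∫⁻ ω, ‖∑ j, Y j ω * Z j ω‖ₑ ^ 2 ∂P ≤ ENNReal.ofReal δ := by
  have hYm : ∀ j, Measurable (Y j) := fun j => (hY j).mono (h.le j) le_rfl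
  have hterm : ∀ j, ∫⁻ ω, ‖Y j ω * Z j ω‖ₑ ^ 2 ∂P ≤
      ∫⁻ ω, ENNReal.ofReal (Y j ω ^ 2 * v j) ∂P := by
    intro j
    have hi : IndepFun (fun ω => ‖Y j ω‖ₑ ^ 2) (fun ω => ‖Z j ω‖ₑ ^ 2) P :=
      (h.indepFun (hY j)).comp (φ := fun x => ‖x‖ₑ ^ 2) (ψ := fun x => ‖x‖ₑ ^ 2)
        (by fun_prop) (by fun_prop)
    have hZm := h.measurable j
    have hYj := hYm j
    simp_rw [enorm_mul, mul_pow]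
    rw [lintegral_mul_eq_lintegral_mul_lintegral_of_indepFun'' (by fun_prop) (by fun_prop) hi]
    refine (mul_le_mul_right (h.lintegral_sq_le j) _).trans ?_
    rw [← lintegral_mul_const _ (by fun_prop)]
    refine lintegral_mono fun ω => ?_
    simp only
    rw [Real.enorm_sq_eq_ofReal, ← ENNReal.ofReal_mul (sq_nonneg _)]
  have hnn : ∀ j ω, 0 ≤ Y j ω ^ 2 * v j := fun j ω => mul_nonneg (sq_nonneg _) (h.nonneg j)
  have hsum : ∑ j, ∫⁻ ω, ENNReal.ofReal (Y j ω ^ 2 * v j) ∂P ≤ ENNReal.ofReal δ := by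
    rw [← lintegral_finsetSum _ fun j _ => by have := hYm j; fun_prop]
    calc _ ≤ ∫⁻ _, ENNReal.ofReal δ ∂P := by
          refine lintegral_mono fun ω => ?_
          rw [← ENNReal.ofReal_sum_of_nonneg fun j _ => hnn j ω]
          exact ENNReal.ofReal_le_ofReal (hδ ω)
      _ = _ := by simp
  have hmem : ∀ j, MemLp (fun ω => Y j ω * Z j ω) 2 P := by
    intro j
    refine memLp_two_of_lintegral_sq_ne_top ((hYm j).mul (h.measurable j)).aestronglyMeasurable ?_
    refine ne_top_of_le_ne_top ENNReal.ofReal_ne_top ((hterm j).trans (le_trans ?_ hsum))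
    exact Finset.single_le_sum (f := fun j => ∫⁻ ω, ENNReal.ofReal (Y j ω ^ 2 * v j) ∂P)
      (fun _ _ => zero_le) (Finset.mem_univ j)
  have horth : ∀ i j, i < j → ∫ ω, (Y i ω * Z i ω) * (Y j ω * Z j ω) ∂P = 0 := by
    intro i j hij
    -- For `i < j` the factor `Y_i Z_i Y_j` belongs to the past of `Z_j`, which is independent of it
    -- and centred.
    have hm1 : Measurable[m j] fun ω => Y i ω * Z i ω * Y j ω :=
      (((hY i).mono (h.mono i j hij.le) le_rfl).mul (h.measurable_past i j hij)).mul (hY j)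
    have h2 := (h.indepFun hm1).integral_fun_mul_eq_mul_integral
      (hm1.mono (h.le j) le_rfl).aestronglyMeasurable (h.measurable j).aestronglyMeasurable
    rw [h.integral_eq_zero, mul_zero] at h2
    rw [← h2]
    exact integral_congr_ae (Eventually.of_forall fun ω => by simp only; ring)
  rw [lintegral_sq_sum_of_orthogonal hmem]
  · exact (Finset.sum_le_sum fun j _ => hterm j).trans hsum
  · intro i j hij
    rcases lt_or_gt_of_ne hij with h1 | h1
    · exact horth i j h1
    · rw [← horth j i h1]
      exact integral_congr_ae (Eventually.of_forall fun ω => mul_comm _ _)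

/-- **Lenglart's inequality** for a discrete martingale transform. -/
lemma IsCentredNoise.measure_transform_le [IsProbabilityMeasure P] (h : IsCentredNoise P m Z v)
    {Y : Fin n → Ω → ℝ} (hY : ∀ j, Measurable[m j] (Y j)) {δ ε : ℝ} (hδ : 0 ≤ δ) (hε : 0 < ε) :
    P {ω | ε ≤ |∑ j, Y j ω * Z j ω|} ≤
      ENNReal.ofReal (δ / ε ^ 2) + P {ω | δ < ∑ j, Y j ω ^ 2 * v j} := by
  classical
  set A : Fin n → Ω → ℝ := fun j ω => ∑ i ∈ Finset.Iic j, Y i ω ^ 2 * v i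
  have hnn : ∀ j ω, 0 ≤ Y j ω ^ 2 * v j := fun j ω => mul_nonneg (sq_nonneg _) (h.nonneg j)
  have hA : ∀ j, Measurable[m j] (A j) := fun j =>
    Finset.measurable_fun_sum _ fun i hi =>
      (((hY i).mono (h.mono i j (Finset.mem_Iic.1 hi)) le_rfl).pow_const 2).mul_const _
  -- Stopping: since `A j` already includes the `j`-th term and is measurable with respect to `m j`,
  -- the stopped coefficients stay adapted and their bracket never overshoots `δ`.
  set Y' : Fin n → Ω → ℝ := fun j ω => if A j ω ≤ δ then Y j ω else 0
  have hY' : ∀ j, Measurable[m j] (Y' j) := fun j =>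
    Measurable.ite (measurableSet_le (hA j) measurable_const) (hY j) measurable_const
  have hbound : ∀ ω, ∑ j, Y' j ω ^ 2 * v j ≤ δ := by
    intro ω
    have e : ∑ j, Y' j ω ^ 2 * v j =
        ∑ j ∈ Finset.univ.filter (fun j => A j ω ≤ δ), Y j ω ^ 2 * v j := by
      rw [Finset.sum_filter]
      refine Finset.sum_congr rfl fun j _ => ?_
      simp only [Y']
      split_ifs <;> simp
    rw [e]
    rcases (Finset.univ.filter (fun j => A j ω ≤ δ)).eq_empty_or_nonempty with h0 | h0
    · rw [h0]; simpa using hδ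
    -- All retained indices are at most the largest one, whose running bracket is at most `δ`;
    -- nonnegativity of the terms does the rest.
    · have hmax := Finset.max'_mem _ h0
      refine le_trans ?_ (Finset.mem_filter.1 hmax).2
      exact Finset.sum_le_sum_of_subset_of_nonneg
        (fun i hi => Finset.mem_Iic.2 (Finset.le_max' _ i hi)) fun i _ _ => hnn i ω
  have hX : Measurable fun ω => ∑ j, Y' j ω * Z j ω :=
    Finset.measurable_fun_sum _ fun j _ => ((hY' j).mono (h.le j) le_rfl).mul (h.measurable j)
  have hcheb : P {ω | ε ≤ |∑ j, Y' j ω * Z j ω|} ≤ ENNReal.ofReal (δ / ε ^ 2) := by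
    have h1 := mul_meas_ge_le_lintegral (μ := P)
      (f := fun ω => ‖∑ j, Y' j ω * Z j ω‖ₑ ^ 2) (by fun_prop) (ENNReal.ofReal (ε ^ 2))
    have h2 := h1.trans (h.lintegral_transform_le hY' hbound)
    have hε2 : 0 < ε ^ 2 := by positivity
    rw [ENNReal.ofReal_div_of_pos hε2, ENNReal.le_div_iff_mul_le (by simp [hε.ne'])
      (by simp), mul_comm]
    refine le_trans (mul_le_mul_right (measure_mono fun ω hω => ?_) _) h2
    simp only [Set.mem_ofPred_eq, Real.enorm_sq_eq_ofReal] at hω ⊢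
    refine ENNReal.ofReal_le_ofReal ?_
    rw [← sq_abs (∑ j, Y' j ω * Z j ω)]
    exact pow_le_pow_left₀ hε.le hω 2
  refine le_trans (measure_mono fun ω hω => ?_)
    ((measure_union_le _ _).trans (add_le_add_left hcheb (P {ω | δ < ∑ j, Y j ω ^ 2 * v j})))
  by_cases hc : δ < ∑ j, Y j ω ^ 2 * v j
  · exact Or.inr hc
  · left
    have : ∀ j, Y' j ω = Y j ω := fun j => if_pos <| le_trans
      (Finset.sum_le_sum_of_subset_of_nonneg (Finset.subset_univ _) fun i _ _ => hnn i ω)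
      (not_lt.1 hc)
    simpa only [Set.mem_ofPred_eq, this] using hω

/-- Martingale transforms tend to zero in probability if their brackets do. -/
lemma tendstoInMeasure_transform [IsProbabilityMeasure P] {ι : Type*} {l : Filter ι}
    {n : ι → ℕ} {m : ∀ i, Fin (n i) → MeasurableSpace Ω} {Z : ∀ i, Fin (n i) → Ω → ℝ}
    {v : ∀ i, Fin (n i) → ℝ} (h : ∀ i, IsCentredNoise P (m i) (Z i) (v i))
    {Y : ∀ i, Fin (n i) → Ω → ℝ} (hY : ∀ i j, Measurable[m i j] (Y i j))
    (hb : TendstoInMeasure P (fun i ω => ∑ j, Y i j ω ^ 2 * v i j) l (fun _ => 0)) :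
    TendstoInMeasure P (fun i ω => ∑ j, Y i j ω * Z i j ω) l (fun _ => 0) := by
  rw [tendstoInMeasure_iff_dist] at hb ⊢
  intro ε hε
  simp only [dist_zero_right, Real.norm_eq_abs] at hb ⊢
  rw [ENNReal.tendsto_nhds_zero]
  intro κ hκ
  rcases eq_or_ne κ ∞ with rfl | hκ'
  · simp
  have hκr : 0 < κ.toReal := ENNReal.toReal_pos hκ.ne' hκ'
  -- Chosen so that the Chebyshev term `δ / ε²` equals `κ / 2`.
  set δ := κ.toReal / 2 * ε ^ 2
  have hδ : 0 < δ := by positivity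
  have h2 : (0 : ℝ≥0∞) < κ / 2 := ENNReal.half_pos hκ.ne'
  filter_upwards [ENNReal.tendsto_nhds_zero.1 (hb δ hδ) _ h2] with i hi
  refine ((h i).measure_transform_le (hY i) hδ.le hε).trans ?_
  have e : ENNReal.ofReal (δ / ε ^ 2) = κ / 2 := by
    rw [mul_div_cancel_right₀ _ (by positivity), ENNReal.ofReal_div_of_pos two_pos,
      ENNReal.ofReal_toReal hκ']
    simp
  rw [e]
  refine (add_le_add_right ((measure_mono fun ω hω => ?_).trans hi) _).trans
    (ENNReal.add_halves κ).le
  have hω' : δ < ∑ j, Y i j ω ^ 2 * v i j := hω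
  exact hω'.le.trans (le_abs_self _)

end MartingaleTransform

/-! ### Gaussian moments and noise built from Brownian increments. -/

section BrownianNoise

lemma integral_sq_gaussianReal (τ : ℝ≥0) : ∫ x, x ^ 2 ∂gaussianReal 0 τ = τ := by
  rw [← variance_fun_id_gaussianReal (μ := 0), variance_of_integral_eq_zero (by fun_prop) (by simp)]

lemma memLp_sq_gaussianReal (μ : ℝ) (τ : ℝ≥0) : MemLp (fun x : ℝ => x ^ 2) 2 (gaussianReal μ τ) := by
  refine memLp_two_of_lintegral_sq_ne_top (by fun_prop) ?_
  have h := (memLp_id_gaussianReal (μ := μ) (v := τ) 4).eLpNorm_lt_top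
  rw [eLpNorm_lt_top_iff_lintegral_rpow_enorm_lt_top (by norm_num) (by norm_num)] at h
  refine ne_top_of_le_ne_top h.ne (lintegral_mono fun x => ?_)
  simp only [enorm_pow, id, ENNReal.coe_ofNat, ENNReal.toReal_ofNat]
  rw [← pow_mul, ← ENNReal.rpow_natCast]
  norm_num

/-- The variance of the square of a standard Gaussian variable. -/
noncomputable def gaussianSquareVariance : ℝ := ∫ z, (z ^ 2 - 1) ^ 2 ∂gaussianReal 0 1

lemma gaussianSquareVariance_nonneg : 0 ≤ gaussianSquareVariance :=
  integral_nonneg fun _ => sq_nonneg _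

lemma integral_centred_sq_gaussianReal (τ : ℝ≥0) :
    ∫ x, (x ^ 2 - τ) ∂gaussianReal 0 τ = 0 := by
  rw [integral_sub ((memLp_sq_gaussianReal 0 τ).integrable (by norm_num)) (integrable_const _),
    integral_sq_gaussianReal]
  simp

/-- Scaling: with `x = √τ z` one has `x² - τ = τ (z² - 1)`. What matters later is that the variance
is quadratic in `τ`; the value of the constant plays no role. -/
lemma lintegral_centred_sq_gaussianReal (τ : ℝ≥0) :
    ∫⁻ x, ‖x ^ 2 - τ‖ₑ ^ 2 ∂gaussianReal 0 τ =
      ENNReal.ofReal (gaussianSquareVariance * τ ^ 2) := by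
  have hmap : gaussianReal 0 τ = (gaussianReal 0 1).map (√(τ : ℝ) * ·) := by
    rw [gaussianReal_map_const_mul]
    congr 1
    · simp
    · ext; simp
  have hm : MemLp (fun z : ℝ => z ^ 2 - 1) 2 (gaussianReal 0 1) :=
    (memLp_sq_gaussianReal 0 1).sub (memLp_const _)
  rw [hmap, lintegral_map (by fun_prop) (by fun_prop), mul_comm,
    ENNReal.ofReal_mul (by positivity), gaussianSquareVariance,
    ← lintegral_sq_eq_ofReal_integral hm, ← lintegral_const_mul _ (by fun_prop)]
  refine lintegral_congr fun z => ?_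
  rw [mul_pow, Real.sq_sqrt τ.coe_nonneg, Real.enorm_sq_eq_ofReal, Real.enorm_sq_eq_ofReal,
    ← ENNReal.ofReal_mul (by positivity)]
  congr 1; ring

variable {Ω : Type*} {mΩ : MeasurableSpace Ω} {P : Measure Ω}
  {𝓕 : Filtration ℝ≥0 mΩ} {W : ℝ≥0 → Ω → ℝ}

namespace IsFilteredBrownian

lemma measurable (hW : IsFilteredBrownian W 𝓕 P) (t : ℝ≥0) : Measurable (W t) :=
  (hW.adapted t).measurable.mono (𝓕.le t) le_rfl

lemma measurable_le (hW : IsFilteredBrownian W 𝓕 P) {s t : ℝ≥0} (hst : s ≤ t) :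
    Measurable[𝓕 t] (W s) :=
  (hW.adapted s).measurable.mono (𝓕.mono hst) le_rfl

lemma hasLaw_increment (hW : IsFilteredBrownian W 𝓕 P) {s r : ℝ≥0} (hsr : s ≤ r) :
    HasLaw (fun ω => W r ω - W s ω) (gaussianReal 0 (r - s)) P := by
  have h := hW.isBrownian.hasLaw_sub r s
  have e : nndist r.1 s.1 = r - s := by
    ext
    rw [NNReal.coe_sub hsr, coe_nndist, Real.dist_eq]
    exact abs_of_nonneg (sub_nonneg.2 (by exact_mod_cast hsr))
  rw [e] at h
  exact h

/-- Centred functions of the increments of a Brownian motion over successive intervals. -/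
lemma isCentredNoise (hW : IsFilteredBrownian W 𝓕 P) {n : ℕ} {s r : Fin n → ℝ≥0}
    (hsr : ∀ j, s j ≤ r j) (hrs : ∀ i j, i < j → r i ≤ s j) {g : Fin n → ℝ → ℝ}
    (hg : ∀ j, Measurable (g j)) {v : Fin n → ℝ}
    (h0 : ∀ j, ∫ x, g j x ∂gaussianReal 0 (r j - s j) = 0) (hv : ∀ j, 0 ≤ v j)
    (h2 : ∀ j, ∫⁻ x, ‖g j x‖ₑ ^ 2 ∂gaussianReal 0 (r j - s j) ≤ ENNReal.ofReal (v j)) :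
    IsCentredNoise P (fun j => 𝓕 (s j)) (fun j ω => g j (W (r j) ω - W (s j) ω)) v where
  le j := 𝓕.le _
  mono i j hij := by
    rcases hij.eq_or_lt with rfl | h
    · exact le_rfl
    · exact 𝓕.mono ((hsr i).trans (hrs i j h))
  measurable j := (hg j).comp ((hW.measurable _).sub (hW.measurable _))
  measurable_past i j hij := (hg i).comp
    ((hW.measurable_le (hrs i j hij)).sub (hW.measurable_le ((hsr i).trans (hrs i j hij))))
  indep j := by
    refine indep_of_indep_of_le_left (hW.indep _ _ (hsr j)) ?_
    exact ((hg j).comp (comap_measurable _)).comap_le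
  integral_eq_zero j := by
    rw [← h0 j]
    exact (hW.hasLaw_increment (hsr j)).integral_comp (hg j).aestronglyMeasurable
  nonneg := hv
  lintegral_sq_le j := by
    refine le_trans (le_of_eq ?_) (h2 j)
    have := hg j
    exact (hW.hasLaw_increment (hsr j)).lintegral_comp (f := fun x => ‖g j x‖ₑ ^ 2) (by fun_prop)

variable {a b : ℝ≥0}

/-- The centred squared increments over initial parts of the subintervals. -/
lemma isCentredNoise_sq (hW : IsFilteredBrownian W 𝓕 P) (π : TimePartition a b) {lam : ℝ≥0}
    (hl : lam ≤ 1) :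
    IsCentredNoise P (fun j => 𝓕 (π.pt j.castSucc))
      (fun j ω => (W (π.tag lam j) ω - W (π.pt j.castSucc) ω) ^ 2 -
        lam * ((π.pt j.succ : ℝ) - π.pt j.castSucc))
      (fun j => gaussianSquareVariance * ((π.pt j.succ : ℝ) - π.pt j.castSucc) ^ 2) := by
  have e : ∀ j, lam * ((π.pt j.succ : ℝ) - π.pt j.castSucc) =
      ((π.tag lam j - π.pt j.castSucc : ℝ≥0) : ℝ) := by
    intro j
    rw [NNReal.coe_sub (π.le_tag hl j), π.coe_tag hl]; ring
  refine hW.isCentredNoise (g := fun j x => x ^ 2 - lam * ((π.pt j.succ : ℝ) - π.pt j.castSucc))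
    (fun j => π.le_tag hl j)
    (fun i j hij => (π.tag_le hl i).trans (π.succ_le_castSucc hij)) (fun j => by fun_prop)
    (fun j => ?_) (fun j => mul_nonneg gaussianSquareVariance_nonneg (sq_nonneg _)) fun j => ?_
  · simp only [e]
    exact integral_centred_sq_gaussianReal _
  · simp only [e, lintegral_centred_sq_gaussianReal]
    refine ENNReal.ofReal_le_ofReal (mul_le_mul_of_nonneg_left ?_ gaussianSquareVariance_nonneg)
    rw [← e, mul_pow]
    have : (lam : ℝ) ≤ 1 := by exact_mod_cast hl
    nlinarith [sq_nonneg ((π.pt j.succ : ℝ) - π.pt j.castSucc),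
      pow_le_one₀ (n := 2) lam.coe_nonneg this]

/-- The increments over final parts of the subintervals. -/
lemma isCentredNoise_increment (hW : IsFilteredBrownian W 𝓕 P) (π : TimePartition a b) {lam : ℝ≥0}
    (hl : lam ≤ 1) :
    IsCentredNoise P (fun j => 𝓕 (π.tag lam j))
      (fun j ω => W (π.pt j.succ) ω - W (π.tag lam j) ω)
      (fun j => (π.pt j.succ : ℝ) - π.pt j.castSucc) := by
  refine hW.isCentredNoise (g := fun _ x => x) (fun j => π.tag_le hl j)
    (fun i j hij => (π.succ_le_castSucc hij).trans (π.le_tag hl j)) (fun j => measurable_id)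
    (fun j => by simp) π.length_nonneg fun j => ?_
  rw [lintegral_sq_eq_ofReal_integral (f := fun x => x) (memLp_id_gaussianReal' 2 (by simp)),
    integral_sq_gaussianReal, NNReal.coe_sub (π.tag_le hl j)]
  have h : (π.pt j.castSucc : ℝ) ≤ π.tag lam j := by exact_mod_cast π.le_tag hl j
  exact ENNReal.ofReal_le_ofReal (by linarith)

lemma tendstoInMeasure_riemannSum [IsProbabilityMeasure P] (hW : IsFilteredBrownian W 𝓕 P)
    {ψ : ℝ → ℝ} (hψ : Continuous ψ) :
    TendstoInMeasure P (fun (π : TimePartition a b) ω => ∑ j : Fin π.n,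
      ψ (W (π.pt j.castSucc) ω) * ((π.pt j.succ : ℝ) - π.pt j.castSucc))
      (TimePartition.diamToZero a b) (fun ω => ∫ t in (a : ℝ)..b, ψ (W t.toNNReal ω)) := by
  refine tendstoInMeasure_of_tendsto_ae_filter (fun π => ?_) ?_
  · exact (Finset.measurable_fun_sum _ fun j _ =>
      (hψ.measurable.comp (hW.measurable _)).mul_const _).aestronglyMeasurable
  · filter_upwards [hW.isBrownian.cont] with ω hω
    exact TimePartition.tendsto_riemannSum (hψ.comp hω)

/-- Weighted sums of squared increments. -/
lemma tendstoInMeasure_sum_sq [IsProbabilityMeasure P] (hW : IsFilteredBrownian W 𝓕 P)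
    {ψ : ℝ → ℝ} (hψ : Continuous ψ) {lam : ℝ≥0} (hl : lam ≤ 1) :
    TendstoInMeasure P (fun (π : TimePartition a b) ω => ∑ j : Fin π.n,
      ψ (W (π.pt j.castSucc) ω) * (W (π.tag lam j) ω - W (π.pt j.castSucc) ω) ^ 2)
      (TimePartition.diamToZero a b)
      (fun ω => lam * ∫ t in (a : ℝ)..b, ψ (W t.toNNReal ω)) := by
  -- Replace each squared increment by its centred version; the compensator `lam * (t_j - t_{j-1})`
  -- that was removed gives a Riemann sum for the limit.
  have h1 := tendstoInMeasure_transform (P := P) (l := TimePartition.diamToZero a b)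
    (fun π => hW.isCentredNoise_sq π hl) (Y := fun π j ω => ψ (W (π.pt j.castSucc) ω))
    (fun π j => hψ.measurable.comp (hW.measurable_le le_rfl)) ?_
  · have h3 := tendstoInMeasure_add h1
      (tendstoInMeasure_const_mul lam (hW.tendstoInMeasure_riemannSum (a := a) (b := b) hψ))
    simp only [zero_add] at h3
    refine h3.congr_left fun π => Eventually.of_forall fun ω => ?_
    simp only
    rw [Finset.mul_sum, ← Finset.sum_add_distrib]
    exact Finset.sum_congr rfl fun j _ => by ring
  · refine tendstoInMeasure_of_tendsto_ae_filter (fun π => ?_) ?_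
    · exact (Finset.measurable_fun_sum _ fun j _ =>
        ((hψ.measurable.comp (hW.measurable _)).pow_const 2).mul_const _).aestronglyMeasurable
    · filter_upwards [hW.isBrownian.cont] with ω hω
      have hr := TimePartition.tendsto_riemannSum (a := a) (b := b)
        (h := fun t => ψ (W t ω) ^ 2) ((hψ.comp hω).pow 2)
      -- The bracket contains squared lengths; one length is bounded by the mesh, and the rest is a
      -- convergent Riemann sum of `ψ(W)²`.
      have hz := (TimePartition.tendsto_diam (a := a) (b := b)).mul
        (hr.const_mul gaussianSquareVariance)
      rw [zero_mul] at hz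
      refine squeeze_zero (fun π => Finset.sum_nonneg fun j _ => mul_nonneg (sq_nonneg _)
        (mul_nonneg gaussianSquareVariance_nonneg (sq_nonneg _))) (fun π => ?_) hz
      rw [Finset.mul_sum, Finset.mul_sum]
      refine Finset.sum_le_sum fun j _ => ?_
      have h3 := mul_le_mul_of_nonneg_left (π.coe_sub_le_diam j)
        (mul_nonneg (mul_nonneg (sq_nonneg (ψ (W (π.pt j.castSucc) ω)))
          gaussianSquareVariance_nonneg) (π.length_nonneg j))
      linarith

/-- Weighted sums of products of successive increments. -/
lemma tendstoInMeasure_sum_cross [IsProbabilityMeasure P] (hW : IsFilteredBrownian W 𝓕 P)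
    {ψ : ℝ → ℝ} (hψ : Continuous ψ) {lam : ℝ≥0} (hl : lam ≤ 1) :
    TendstoInMeasure P (fun (π : TimePartition a b) ω => ∑ j : Fin π.n,
      (ψ (W (π.pt j.castSucc) ω) * (W (π.tag lam j) ω - W (π.pt j.castSucc) ω)) *
        (W (π.pt j.succ) ω - W (π.tag lam j) ω))
      (TimePartition.diamToZero a b) (fun _ => 0) := by
  refine tendstoInMeasure_transform (P := P) (l := TimePartition.diamToZero a b)
    (fun π => hW.isCentredNoise_increment π hl)
    (Y := fun π j ω => ψ (W (π.pt j.castSucc) ω) *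
      (W (π.tag lam j) ω - W (π.pt j.castSucc) ω))
    (fun π j => (hψ.measurable.comp (hW.measurable_le (π.le_tag hl j))).mul
      ((hW.measurable_le le_rfl).sub (hW.measurable_le (π.le_tag hl j)))) ?_
  refine tendstoInMeasure_of_tendsto_ae_filter (fun π => ?_) ?_
  · exact (Finset.measurable_fun_sum _ fun j _ =>
      (((hψ.measurable.comp (hW.measurable _)).mul
        ((hW.measurable _).sub (hW.measurable _))).pow_const 2).mul_const _).aestronglyMeasurable
  · filter_upwards [hW.isBrownian.cont] with ω hω
    have hr := TimePartition.tendsto_riemannSum (a := a) (b := b)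
      (h := fun t => ψ (W t ω) ^ 2) ((hψ.comp hω).pow 2)
    set q := ∫ t in (a : ℝ)..b, ψ (W t.toNNReal ω) ^ 2
    rw [Metric.tendsto_nhds]
    intro ε hε
    -- The bracket is at most `η²` times a Riemann sum that is eventually below `|q| + 1`, hence at
    -- most `ε / 2`.
    have hη : 0 < √(ε / (2 * (|q| + 1))) := by positivity
    filter_upwards [TimePartition.eventually_osc_le hω hη,
      hr.eventually (eventually_lt_nhds (lt_of_le_of_lt (le_abs_self q) (lt_add_one |q|)))]
      with π h1 h2
    rw [dist_zero_right, Real.norm_eq_abs, abs_of_nonneg (Finset.sum_nonneg fun j _ =>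
      mul_nonneg (sq_nonneg _) (π.length_nonneg j))]
    calc _ ≤ ∑ j : Fin π.n, ε / (2 * (|q| + 1)) *
          (ψ (W (π.pt j.castSucc) ω) ^ 2 * ((π.pt j.succ : ℝ) - π.pt j.castSucc)) := by
          refine Finset.sum_le_sum fun j _ => ?_
          have h3 := h1 j _ ⟨π.le_tag hl j, π.tag_le hl j⟩ _ ⟨le_rfl, π.pt_le j⟩
          have h4 := pow_le_pow_left₀ (abs_nonneg _) h3 2
          rw [sq_abs, Real.sq_sqrt (by positivity)] at h4
          have h5 := mul_le_mul_of_nonneg_right h4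
            (mul_nonneg (sq_nonneg (ψ (W (π.pt j.castSucc) ω))) (π.length_nonneg j))
          rw [mul_pow]
          linarith
      _ ≤ ε / (2 * (|q| + 1)) * (|q| + 1) := by
          rw [← Finset.mul_sum]
          exact mul_le_mul_of_nonneg_left h2.le (by positivity)
      _ < ε := by
          have : 0 < |q| + 1 := by positivity
          field_simp
          linarith

end IsFilteredBrownian

end BrownianNoise

/-! ### Taylor estimates through the oscillation of the highest derivative. -/

section Taylor

/-- First-order Taylor estimate with the oscillation of the derivative. -/
lemma abs_taylor_one_le {Φ φ : ℝ → ℝ} (hΦ : ∀ z, HasDerivAt Φ (φ z) z) {x y η : ℝ}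
    (hη : ∀ z ∈ Set.uIcc x y, |φ z - φ x| ≤ η) :
    |Φ y - Φ x - φ x * (y - x)| ≤ η * |y - x| := by
  have h := (convex_uIcc x y).norm_image_sub_le_of_norm_hasDerivWithin_le
    (f := fun z => Φ z - φ x * z) (f' := fun z => φ z - φ x) (C := η) (x := x) (y := y)
    (fun z _ => by
      refine (((hΦ z).sub ((hasDerivAt_id z).const_mul (φ x))).congr_deriv ?_).hasDerivWithinAt
      simp)
    hη Set.left_mem_uIcc Set.right_mem_uIcc
  rw [Real.norm_eq_abs, Real.norm_eq_abs] at h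
  refine le_trans (le_of_eq ?_) h
  congr 1; ring

/-- Second-order Taylor estimate with the oscillation of the second derivative. -/
lemma abs_taylor_two_le {F Φ φ : ℝ → ℝ} (hF : ∀ z, HasDerivAt F (Φ z) z)
    (hΦ : ∀ z, HasDerivAt Φ (φ z) z) {x y η : ℝ}
    (hη : ∀ z ∈ Set.uIcc x y, |φ z - φ x| ≤ η) :
    |F y - F x - Φ x * (y - x) - 1 / 2 * (φ x * (y - x) ^ 2)| ≤ η * (y - x) ^ 2 := by
  have hη0 : 0 ≤ η := (abs_nonneg _).trans (hη x Set.left_mem_uIcc)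
  -- Mean value inequality for `F` minus its quadratic Taylor part; the derivative of that
  -- difference is the first-order remainder of `Φ`. No second derivative of `Φ` is needed.
  have h := (convex_uIcc x y).norm_image_sub_le_of_norm_hasDerivWithin_le
    (f := fun z => F z - Φ x * z - 1 / 2 * (φ x * (z - x) ^ 2))
    (f' := fun z => Φ z - Φ x - φ x * (z - x)) (C := η * |y - x|) (x := x) (y := y)
    (fun z _ => by
      have h1 := ((((hasDerivAt_id z).sub_const x).pow 2).const_mul (φ x)).const_mul (1 / 2 : ℝ)
      have h2 := ((hF z).sub ((hasDerivAt_id z).const_mul (Φ x))).sub h1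
      refine (h2.congr_deriv ?_).hasDerivWithinAt
      simp; ring)
    (fun z hz => by
      have hsub : Set.uIcc x z ⊆ Set.uIcc x y := Set.uIcc_subset_uIcc_left hz
      refine (abs_taylor_one_le hΦ fun w hw => hη w (hsub hw)).trans ?_
      exact mul_le_mul_of_nonneg_left (Set.abs_sub_left_of_mem_uIcc hz) hη0)
    Set.left_mem_uIcc Set.right_mem_uIcc
  rw [Real.norm_eq_abs, Real.norm_eq_abs, mul_assoc, ← sq, sq_abs] at h
  refine le_trans (le_of_eq ?_) h
  congr 1; ring

/-- Values between two values of a continuous path are taken in between. -/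
lemma abs_sub_le_of_mem_uIcc {x : ℝ≥0 → ℝ} (hx : Continuous x) {φ : ℝ → ℝ} {s t : ℝ≥0}
    (hst : s ≤ t) {η : ℝ} (h : ∀ u ∈ Set.Icc s t, |φ (x u) - φ (x s)| ≤ η) :
    ∀ z ∈ Set.uIcc (x s) (x t), |φ z - φ (x s)| ≤ η := by
  intro z hz
  obtain ⟨u, hu, rfl⟩ := intermediate_value_uIcc hx.continuousOn hz
  rw [Set.uIcc_of_le hst] at hu
  exact h u hu

end Taylor

/-! ### Limits of left-point and intermediate-point sums. -/

section RiemannSums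

variable {Ω : Type*} {mΩ : MeasurableSpace Ω} {P : Measure Ω}

lemma tendstoInMeasure_const {ι : Type*} (l : Filter ι) (f : Ω → ℝ) :
    TendstoInMeasure P (fun _ => f) l f := by
  intro ε hε
  simpa [hε.ne'] using tendsto_const_nhds

/-- If `|R| ≤ η Q` eventually, for every `η > 0`, where `Q` converges in measure, then `R` tends to
zero in measure. -/
lemma tendstoInMeasure_zero_of_abs_le_mul [IsFiniteMeasure P] {ι : Type*} {l : Filter ι}
    [l.IsCountablyGenerated] {R Q : ι → Ω → ℝ} {q : Ω → ℝ} (hQ : TendstoInMeasure P Q l q)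
    (hR : ∀ i, Measurable (R i))
    (h : ∀ᵐ ω ∂P, ∀ η : ℝ, 0 < η → ∀ᶠ i in l, |R i ω| ≤ η * Q i ω) :
    TendstoInMeasure P R l (fun _ => 0) := by
  refine tendstoInMeasure_of_controlled hQ (fun i => (hR i).aestronglyMeasurable) ?_
  filter_upwards [h] with ω hω u hu hq
  rw [Metric.tendsto_nhds]
  intro ε hε
  have hp : 0 < |q ω| + 1 := by positivity
  filter_upwards [hu.eventually (hω (ε / (2 * (|q ω| + 1))) (by positivity)),
    hq.eventually (eventually_lt_nhds (lt_of_le_of_lt (le_abs_self (q ω)) (lt_add_one |q ω|)))]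
    with n h1 h2
  rw [dist_zero_right, Real.norm_eq_abs]
  calc _ ≤ _ := h1
    _ ≤ ε / (2 * (|q ω| + 1)) * (|q ω| + 1) :=
        mul_le_mul_of_nonneg_left h2.le (by positivity)
    _ < ε := by field_simp; linarith

variable {𝓕 : Filtration ℝ≥0 mΩ} {W : ℝ≥0 → Ω → ℝ} {a b : ℝ≥0}

/-- The Riemann sum of `Φ(W)` with evaluation at the left end points. -/
noncomputable def leftSum (W : ℝ≥0 → Ω → ℝ) (Φ : ℝ → ℝ) {a b : ℝ≥0} (π : TimePartition a b)
    (ω : Ω) : ℝ :=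
  ∑ j : Fin π.n, Φ (W (π.pt j.castSucc) ω) * (W (π.pt j.succ) ω - W (π.pt j.castSucc) ω)

/-- The limit of the left Riemann sums, as given by Itô's formula. -/
noncomputable def itoLimit (W : ℝ≥0 → Ω → ℝ) (Φ : ℝ → ℝ) (a b : ℝ≥0) (ω : Ω) : ℝ :=
  (∫ x in (0 : ℝ)..W b ω, Φ x) - (∫ x in (0 : ℝ)..W a ω, Φ x) -
    1 / 2 * ∫ t in (a : ℝ)..b, deriv Φ (W t.toNNReal ω)

namespace IsFilteredBrownian

lemma measurable_leftSum (hW : IsFilteredBrownian W 𝓕 P) {Φ : ℝ → ℝ} (hΦ : Continuous Φ)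
    (π : TimePartition a b) : Measurable (leftSum W Φ π) :=
  Finset.measurable_fun_sum _ fun _ _ => (hΦ.measurable.comp (hW.measurable _)).mul
    ((hW.measurable _).sub (hW.measurable _))

lemma measurable_fehlbergSum (hW : IsFilteredBrownian W 𝓕 P) {Φ : ℝ → ℝ} (hΦ : Continuous Φ)
    (π : TimePartition a b) : Measurable (fehlbergSum W Φ π) :=
  Finset.measurable_fun_sum _ fun _ _ => (hΦ.measurable.comp (hW.measurable _)).mul
    ((hW.measurable _).sub (hW.measurable _))

/-- **Itô's formula** for an antiderivative of `Φ`. -/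
lemma tendstoInMeasure_leftSum [IsProbabilityMeasure P] (hW : IsFilteredBrownian W 𝓕 P)
    {Φ : ℝ → ℝ} (hΦ : ContDiff ℝ 1 Φ) :
    TendstoInMeasure P (fun π : TimePartition a b => leftSum W Φ π)
      (TimePartition.diamToZero a b) (itoLimit W Φ a b) := by
  set F : ℝ → ℝ := fun y => ∫ x in (0 : ℝ)..y, Φ x
  have hF : ∀ z, HasDerivAt F (Φ z) z := fun z => hΦ.continuous.integral_hasStrictDerivAt 0 z
    |>.hasDerivAt
  have hΦ' : ∀ z, HasDerivAt Φ (deriv Φ z) z := fun z =>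
    (hΦ.differentiable (by norm_num) z).hasDerivAt
  have hφ : Continuous (deriv Φ) := hΦ.continuous_deriv_one
  have hFm : Measurable F := (continuous_iff_continuousAt.2 fun z => (hF z).continuousAt).measurable
  have hQ := hW.tendstoInMeasure_sum_sq (a := a) (b := b) (ψ := fun _ => 1) continuous_const le_rfl
  have hS := hW.tendstoInMeasure_sum_sq (a := a) (b := b) hφ le_rfl
  simp only [TimePartition.tag_one, one_mul, NNReal.coe_one] at hQ hS
  -- The summed Taylor remainder: the increments of `F` telescope, and the error is at most the
  -- oscillation of `deriv Φ` along the path times the convergent quadratic variation `hQ`.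
  have hR : TendstoInMeasure P (fun (π : TimePartition a b) ω =>
      F (W b ω) - F (W a ω) - leftSum W Φ π ω - 1 / 2 * ∑ j : Fin π.n,
        deriv Φ (W (π.pt j.castSucc) ω) * (W (π.pt j.succ) ω - W (π.pt j.castSucc) ω) ^ 2)
      (TimePartition.diamToZero a b) (fun _ => 0) := by
    refine tendstoInMeasure_zero_of_abs_le_mul hQ (fun π => ?_) ?_
    · refine (((hFm.comp (hW.measurable _)).sub (hFm.comp (hW.measurable _))).sub
        (hW.measurable_leftSum hΦ.continuous π)).sub (Measurable.const_mul ?_ _)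
      exact Finset.measurable_fun_sum _ fun j _ => (hφ.measurable.comp (hW.measurable _)).mul
        (((hW.measurable _).sub (hW.measurable _)).pow_const 2)
    · filter_upwards [hW.isBrownian.cont] with ω hω η hη
      filter_upwards [TimePartition.eventually_osc_le (hφ.comp hω) hη] with π hπ
      have htel := Fin.sum_succ_sub_castSucc (fun i => F (W (π.pt i) ω))
      rw [π.first, π.last] at htel
      rw [← htel, leftSum, Finset.mul_sum, ← Finset.sum_sub_distrib, ← Finset.sum_sub_distrib,
        Finset.mul_sum]
      refine (Finset.abs_sum_le_sum_abs _ _).trans (Finset.sum_le_sum fun j _ => ?_)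
      exact abs_taylor_two_le hF hΦ' (abs_sub_le_of_mem_uIcc hω (π.pt_le j)
        fun u hu => hπ j u hu _ ⟨le_rfl, π.pt_le j⟩)
  have h := tendstoInMeasure_add (tendstoInMeasure_add
    (tendstoInMeasure_const (TimePartition.diamToZero a b) fun ω => F (W b ω) - F (W a ω))
    (tendstoInMeasure_const_mul (-1) hR)) (tendstoInMeasure_const_mul (-(1 / 2)) hS)
  refine h.congr (fun π => Eventually.of_forall fun ω => ?_) (Eventually.of_forall fun ω => ?_)
  · ring
  · simp only [itoLimit, F]; ring

/-- The correction term for Riemann sums with evaluation at intermediate points. -/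
lemma tendstoInMeasure_tagSum_sub_leftSum [IsProbabilityMeasure P]
    (hW : IsFilteredBrownian W 𝓕 P) {Φ : ℝ → ℝ} (hΦ : ContDiff ℝ 1 Φ) {lam : ℝ≥0} (hl : lam ≤ 1) :
    TendstoInMeasure P (fun (π : TimePartition a b) ω =>
      ∑ j : Fin π.n, (Φ (W (π.tag lam j) ω) - Φ (W (π.pt j.castSucc) ω)) *
        (W (π.pt j.succ) ω - W (π.pt j.castSucc) ω))
      (TimePartition.diamToZero a b)
      (fun ω => lam * ∫ t in (a : ℝ)..b, deriv Φ (W t.toNNReal ω)) := by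
  have hΦ' : ∀ z, HasDerivAt Φ (deriv Φ z) z := fun z =>
    (hΦ.differentiable (by norm_num) z).hasDerivAt
  have hφ : Continuous (deriv Φ) := hΦ.continuous_deriv_one
  have hΦm := hΦ.continuous.measurable
  have hQ1 := hW.tendstoInMeasure_sum_sq (a := a) (b := b) (ψ := fun _ => 1) continuous_const
    (le_refl (1 : ℝ≥0))
  have hQ2 := hW.tendstoInMeasure_sum_sq (a := a) (b := b) (ψ := fun _ => 1) continuous_const hl
  simp only [TimePartition.tag_one, one_mul, NNReal.coe_one] at hQ1 hQ2
  -- The remainder below pairs two different increments, over the initial part and over the whole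
  -- subinterval; `|u v| ≤ u² + v²` bounds it by the sum of both quadratic variations.
  have hQ := tendstoInMeasure_add hQ1 hQ2
  have hS := hW.tendstoInMeasure_sum_sq (a := a) (b := b) hφ hl
  have hC := hW.tendstoInMeasure_sum_cross (a := a) (b := b) hφ hl
  have hR : TendstoInMeasure P (fun (π : TimePartition a b) ω =>
      ∑ j : Fin π.n, (Φ (W (π.tag lam j) ω) - Φ (W (π.pt j.castSucc) ω) -
        deriv Φ (W (π.pt j.castSucc) ω) * (W (π.tag lam j) ω - W (π.pt j.castSucc) ω)) *
        (W (π.pt j.succ) ω - W (π.pt j.castSucc) ω))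
      (TimePartition.diamToZero a b) (fun _ => 0) := by
    refine tendstoInMeasure_zero_of_abs_le_mul hQ (fun π => ?_) ?_
    · exact Finset.measurable_fun_sum _ fun j _ => (((hΦm.comp (hW.measurable _)).sub
        (hΦm.comp (hW.measurable _))).sub ((hφ.measurable.comp (hW.measurable _)).mul
          ((hW.measurable _).sub (hW.measurable _)))).mul
          ((hW.measurable _).sub (hW.measurable _))
    · filter_upwards [hW.isBrownian.cont] with ω hω η hη
      filter_upwards [TimePartition.eventually_osc_le (hφ.comp hω) hη] with π hπ
      rw [← Finset.sum_add_distrib, Finset.mul_sum]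
      refine (Finset.abs_sum_le_sum_abs _ _).trans (Finset.sum_le_sum fun j _ => ?_)
      have h1 := abs_taylor_one_le hΦ' (abs_sub_le_of_mem_uIcc hω (π.le_tag hl j)
        fun u hu => hπ j u ⟨hu.1, hu.2.trans (π.tag_le hl j)⟩ _ ⟨le_rfl, π.pt_le j⟩)
      rw [abs_mul]
      refine (mul_le_mul_of_nonneg_right h1 (abs_nonneg _)).trans ?_
      rw [mul_assoc]
      refine mul_le_mul_of_nonneg_left ?_ hη.le
      rw [← sq_abs (W (π.pt j.succ) ω - _), ← sq_abs (W (π.tag lam j) ω - _)]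
      nlinarith [sq_nonneg (|W (π.pt j.succ) ω - W (π.pt j.castSucc) ω| -
        |W (π.tag lam j) ω - W (π.pt j.castSucc) ω|),
        abs_nonneg (W (π.pt j.succ) ω - W (π.pt j.castSucc) ω),
        abs_nonneg (W (π.tag lam j) ω - W (π.pt j.castSucc) ω)]
  -- After linearising `Φ` at the left end point and splitting the increment at the tag, these are
  -- the square part, the cross part and the remainder.
  have h := tendstoInMeasure_add (tendstoInMeasure_add hS hC) hR
  simp only [add_zero] at h
  refine h.congr_left fun π => Eventually.of_forall fun ω => ?_
  simp only
  rw [← Finset.sum_add_distrib, ← Finset.sum_add_distrib]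
  exact Finset.sum_congr rfl fun j _ => by ring

lemma tendstoInMeasure_fehlbergSum [IsProbabilityMeasure P] (hW : IsFilteredBrownian W 𝓕 P)
    {Φ : ℝ → ℝ} (hΦ : ContDiff ℝ 1 Φ) :
    TendstoInMeasure P (fun π : TimePartition a b => fehlbergSum W Φ π)
      (TimePartition.diamToZero a b) (fun ω => itoLimit W Φ a b ω +
        (255 / 512 : ℝ) * ∫ t in (a : ℝ)..b, deriv Φ (W t.toNNReal ω)) := by
  have hl : (255 / 512 : ℝ≥0) ≤ 1 := by
    rw [div_le_one (by norm_num)]; norm_num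
  have h := tendstoInMeasure_add (hW.tendstoInMeasure_leftSum (a := a) (b := b) hΦ)
    (hW.tendstoInMeasure_tagSum_sub_leftSum hΦ hl)
  refine h.congr (fun π => Eventually.of_forall fun ω => ?_) (Eventually.of_forall fun ω => ?_)
  · simp only [leftSum, fehlbergSum]
    rw [← Finset.sum_add_distrib]
    refine Finset.sum_congr rfl fun j _ => ?_
    rw [← add_mul, add_sub_cancel]
    -- `fehlbergPt` is by definition `tag` at `255 / 512`.
    rfl
  · simp

end IsFilteredBrownian

end RiemannSums

/-! ### The Itô integral: existence and independence of the approximating sequence. -/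

section ItoIntegral

variable {Ω : Type*} {mΩ : MeasurableSpace Ω} {P : Measure Ω}

/-- Convergence to zero in probability of extended nonnegative variables, by truncation. -/
lemma tendsto_measure_ge_iff_tendstoInMeasure_min {G : ℕ → Ω → ℝ≥0∞} :
    (∀ ε : ℝ≥0∞, 0 < ε → Tendsto (fun n => P {ω | ε ≤ G n ω}) atTop (𝓝 0)) ↔
      TendstoInMeasure P (fun n ω => (min 1 (G n ω)).toReal) atTop (fun _ => 0) := by
  have hne : ∀ x : ℝ≥0∞, min 1 x ≠ ∞ := fun x =>
    ne_top_of_le_ne_top ENNReal.one_ne_top (min_le_left _ _)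
  rw [tendstoInMeasure_iff_dist]
  constructor
  · intro h ε hε
    refine tendsto_of_tendsto_of_tendsto_of_le_of_le tendsto_const_nhds
      (h _ (ENNReal.ofReal_pos.2 hε)) (fun _ => zero_le) fun n => measure_mono fun ω hω => ?_
    simp only [Set.mem_ofPred_eq, dist_zero_right, Real.norm_eq_abs,
      abs_of_nonneg ENNReal.toReal_nonneg] at hω ⊢
    exact ((ENNReal.ofReal_le_iff_le_toReal (hne _)).2 hω).trans (min_le_right _ _)
  · intro h ε hε
    have hpos : 0 < (min 1 ε).toReal := ENNReal.toReal_pos (lt_min one_pos hε).ne' (hne _)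
    refine tendsto_of_tendsto_of_tendsto_of_le_of_le tendsto_const_nhds
      (h _ hpos) (fun _ => zero_le) fun n => measure_mono fun ω hω => ?_
    simp only [Set.mem_ofPred_eq, dist_zero_right, Real.norm_eq_abs,
      abs_of_nonneg ENNReal.toReal_nonneg] at hω ⊢
    exact ENNReal.toReal_mono (hne _) (min_le_min_left _ hω)

variable {𝓕 : Filtration ℝ≥0 mΩ} {W : ℝ≥0 → Ω → ℝ} {a b : ℝ≥0}

namespace IsFilteredBrownian

lemma aemeasurable_lintegral_sq_sub (hW : IsFilteredBrownian W 𝓕 P) {Φ : ℝ → ℝ}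
    (hΦ : Continuous Φ) (π : TimePartition a b) {Y : Fin π.n → Ω → ℝ}
    (hY : ∀ j, Measurable (Y j)) :
    AEMeasurable (fun ω => ∫⁻ t in Set.Icc (a : ℝ) b,
      ‖π.stepFun (fun j => Y j ω) t.toNNReal - Φ (W t.toNNReal ω)‖ₑ ^ 2) P := by
  obtain ⟨G, hG, hGm, hGc⟩ : ∃ G ∈ ae P, MeasurableSet G ∧
      ∀ ω ∈ G, Continuous fun t => W t ω :=
    (Eventually.exists_measurable_mem hW.isBrownian.cont)
  -- Paths are continuous only almost surely. Setting them to zero off a measurable set of full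
  -- measure makes every path continuous, which yields joint measurability.
  set W' : ℝ≥0 → Ω → ℝ := fun t => G.indicator (W t)
  have hW'm : Measurable (Function.uncurry W') := by
    refine measurable_uncurry_of_continuous_of_measurable (fun ω => ?_)
      fun t => (hW.measurable t).indicator hGm
    by_cases hω : ω ∈ G
    · simpa [W', hω] using hGc ω hω
    · simpa [W', hω] using continuous_const
  have hstep : Measurable fun p : Ω × ℝ => π.stepFun (fun j => Y j p.1) p.2.toNNReal := by
    refine Finset.measurable_fun_sum _ fun j _ => ?_
    have e : (fun p : Ω × ℝ => (Set.Ioc (π.pt j.castSucc) (π.pt j.succ)).indicator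
        (fun _ => Y j p.1) p.2.toNNReal) =
        ({p : Ω × ℝ | p.2.toNNReal ∈ Set.Ioc (π.pt j.castSucc) (π.pt j.succ)}).indicator
          (fun p => Y j p.1) := by
      ext p; simp [Set.indicator]
    rw [e]
    exact ((hY j).comp measurable_fst).indicator
      ((measurable_real_toNNReal.comp measurable_snd) measurableSet_Ioc)
  have hmeas : Measurable fun ω => ∫⁻ t in Set.Icc (a : ℝ) b,
      ‖π.stepFun (fun j => Y j ω) t.toNNReal - Φ (W' t.toNNReal ω)‖ₑ ^ 2 := by
    refine Measurable.lintegral_prod_right' (f := fun p : Ω × ℝ =>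
      ‖π.stepFun (fun j => Y j p.1) p.2.toNNReal - Φ (W' p.2.toNNReal p.1)‖ₑ ^ 2) ?_
    have h2 : Measurable fun p : Ω × ℝ => Φ (W' p.2.toNNReal p.1) :=
      hΦ.measurable.comp (hW'm.comp
        ((measurable_real_toNNReal.comp measurable_snd).prodMk measurable_fst))
    exact ((hstep.sub h2).enorm).pow_const 2
  refine ⟨_, hmeas, ?_⟩
  filter_upwards [hG] with ω hω
  simp [W', hω]

/-- Left-point simple processes with truncated values. -/
noncomputable def truncatedSimpleProcess (hW : IsFilteredBrownian W 𝓕 P) {Φ : ℝ → ℝ}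
    (hΦ : Continuous Φ) (π : TimePartition a b) (n : ℕ) : ItoSimpleProcess 𝓕 a b where
  toTimePartition := π
  ξ j ω := max (-(n : ℝ)) (min n (Φ (W (π.pt j.castSucc) ω)))
  measurable_ξ _ := measurable_const.max
    (measurable_const.min (hΦ.measurable.comp (hW.measurable_le le_rfl)))
  bounded_ξ _ := ⟨n, fun _ => abs_le.2 ⟨le_max_left _ _,
    max_le ((neg_nonpos.2 n.cast_nonneg).trans n.cast_nonneg) (min_le_left _ _)⟩⟩

/-- The path of `Φ(W)` is bounded on `[a, b]`, so the truncation at level `n` eventually does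
nothing, at all partition points at once. The threshold depends on `ω`, which almost sure arguments
tolerate. -/
lemma eventually_truncatedSimpleProcess_ξ_eq (hW : IsFilteredBrownian W 𝓕 P) {Φ : ℝ → ℝ}
    (hΦ : Continuous Φ) (u : ℕ → TimePartition a b) {ω : Ω} (hω : Continuous fun t => W t ω) :
    ∀ᶠ n in atTop, ∀ j, (hW.truncatedSimpleProcess hΦ (u n) n).ξ j ω =
      Φ (W ((u n).pt j.castSucc) ω) := by
  obtain ⟨M, hM⟩ := (isCompact_Icc (a := a) (b := b)).exists_bound_of_continuousOn
    (hΦ.comp hω).continuousOn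
  filter_upwards [eventually_ge_atTop ⌈M⌉₊] with n hn j
  have h1 := abs_le.1 ((hM _ ⟨(u n).le_pt j.castSucc, (u n).pt_le_last j.castSucc⟩).trans
    (Nat.ceil_le.1 hn))
  simp only [Function.comp] at h1
  change max (-(n : ℝ)) (min n (Φ (W ((u n).pt j.castSucc) ω))) = _
  rw [min_eq_right h1.2, max_eq_right h1.1]

lemma exists_isItoIntegral [IsProbabilityMeasure P] (hW : IsFilteredBrownian W 𝓕 P)
    (hab : a < b) {Φ : ℝ → ℝ} (hΦ : ContDiff ℝ 1 Φ) :
    IsItoIntegral P 𝓕 W (fun t ω => Φ (W t ω)) a b (itoLimit W Φ a b) := by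
  have hc := hΦ.continuous
  have hba : (0 : ℝ) < b - a := sub_pos.2 (by exact_mod_cast hab)
  obtain ⟨u, hu⟩ := TimePartition.exists_seq_tendsto_diamToZero hab
  have hL := (hW.tendstoInMeasure_leftSum (a := a) (b := b) hΦ).comp hu
  have hLm : AEMeasurable (itoLimit W Φ a b) P :=
    hL.aemeasurable fun n => (hW.measurable_leftSum hc (u n)).aemeasurable
  have hξm : ∀ n j, Measurable ((hW.truncatedSimpleProcess hc (u n) n).ξ j) := fun n j =>
    ((hW.truncatedSimpleProcess hc (u n) n).measurable_ξ j).mono (𝓕.le _) le_rfl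
  refine ⟨hLm, fun t => hc.comp_stronglyMeasurable (hW.adapted t), ?_,
    fun n => hW.truncatedSimpleProcess hc (u n) n, ?_, ?_⟩
  · filter_upwards [hW.isBrownian.cont] with ω hω
    have hcont : Continuous fun t : ℝ => Φ (W t.toNNReal ω) :=
      hc.comp (hω.comp continuous_real_toNNReal)
    obtain ⟨M, hM⟩ := (isCompact_Icc (a := (a : ℝ)) (b := b)).exists_bound_of_continuousOn
      hcont.continuousOn
    exact MemLp.of_bound hcont.aestronglyMeasurable M
      ((ae_restrict_iff' measurableSet_Icc).2 (Eventually.of_forall hM))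
  · rw [tendsto_measure_ge_iff_tendstoInMeasure_min]
    refine tendstoInMeasure_of_tendsto_ae (fun n => ?_) ?_
    · exact ((aemeasurable_const.min (hW.aemeasurable_lintegral_sq_sub hc (u n)
        (hξm n))).ennreal_toReal).aestronglyMeasurable
    · filter_upwards [hW.isBrownian.cont] with ω hω
      have hG : Tendsto (fun n => ∫⁻ t in Set.Icc (a : ℝ) b,
          ‖(hW.truncatedSimpleProcess hc (u n) n).val t.toNNReal ω -
            Φ (W t.toNNReal ω)‖ₑ ^ 2) atTop (𝓝 0) := by
        rw [ENNReal.tendsto_nhds_zero]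
        intro κ hκ
        rcases eq_or_ne κ ∞ with rfl | hκ'
        · simp
        have hκr : 0 < κ.toReal := ENNReal.toReal_pos hκ.ne' hκ'
        -- Oscillation at most `η` makes the squared `L²` distance at most `η² (b - a) = κ`.
        have hη : 0 < √(κ.toReal / (b - a)) := by positivity
        filter_upwards [hu.eventually (TimePartition.eventually_osc_le (hc.comp hω) hη),
          hW.eventually_truncatedSimpleProcess_ξ_eq hc u hω] with n h1 h2
        refine (TimePartition.lintegral_sq_le
          (g := fun t => (hW.truncatedSimpleProcess hc (u n) n).val t ω - Φ (W t ω))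
          (η := √(κ.toReal / (b - a))) fun t ht => ?_).trans (le_of_eq ?_)
        · obtain ⟨j, hj⟩ := (u n).exists_mem_Ioc ht
          have e : (hW.truncatedSimpleProcess hc (u n) n).val t ω =
              Φ (W ((u n).pt j.castSucc) ω) := ((u n).stepFun_of_mem _ hj).trans (h2 j)
          rw [e]
          exact h1 j _ ⟨le_rfl, (u n).pt_le j⟩ _ (Set.Ioc_subset_Icc_self hj)
        · rw [Real.sq_sqrt (by positivity), div_mul_cancel₀ _ hba.ne', ENNReal.ofReal_toReal hκ']
      have h2 := (tendsto_const_nhds (x := (1 : ℝ≥0∞))).min hG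
      simp only [zero_le, inf_of_le_right] at h2
      exact (ENNReal.tendsto_toReal ENNReal.zero_ne_top).comp h2
  -- On almost every path this difference is eventually zero, since the truncation becomes inactive.
  · have hd : TendstoInMeasure P (fun n ω =>
        (hW.truncatedSimpleProcess hc (u n) n).integral W ω - leftSum W Φ (u n) ω) atTop
        (fun _ => 0) := by
      refine tendstoInMeasure_of_tendsto_ae (fun n => ?_) ?_
      · refine (Measurable.sub ?_ (hW.measurable_leftSum hc _)).aestronglyMeasurable
        exact Finset.measurable_fun_sum _ fun j _ => (hξm n j).mul
          ((hW.measurable _).sub (hW.measurable _))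
      · filter_upwards [hW.isBrownian.cont] with ω hω
        refine tendsto_const_nhds.congr' ?_
        filter_upwards [hW.eventually_truncatedSimpleProcess_ξ_eq hc u hω] with n hn
        simp only [ItoSimpleProcess.integral, hn]
        exact (sub_self _).symm
    have h := tendstoInMeasure_add hd hL
    simp only [zero_add, Function.comp] at h
    exact h.congr_left fun n => Eventually.of_forall fun ω => by simp

/-- Simple processes approximating `Φ(W)` have integrals tending to the limit of the left
Riemann sums. -/
lemma tendstoInMeasure_simpleIntegral [IsProbabilityMeasure P] (hW : IsFilteredBrownian W 𝓕 P)
    (hab : a < b) {Φ : ℝ → ℝ} (hΦ : ContDiff ℝ 1 Φ) {H : ℕ → ItoSimpleProcess 𝓕 a b}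
    (hH : ∀ ε : ℝ≥0∞, 0 < ε → Tendsto (fun n => P {ω | ε ≤ ∫⁻ t in Set.Icc (a : ℝ) (b : ℝ),
        ‖(H n).val t.toNNReal ω - Φ (W t.toNNReal ω)‖ₑ ^ 2}) atTop (𝓝 0)) :
    TendstoInMeasure P (fun n => (H n).integral W) atTop (itoLimit W Φ a b) := by
  have hc := hΦ.continuous
  have hba : (0 : ℝ) < b - a := sub_pos.2 (by exact_mod_cast hab)
  have hex : ∀ n : ℕ, ∃ π' : TimePartition a b, π'.diam ≤ 1 / (n + 1) ∧
      π'.Refines (H n).toTimePartition := fun n =>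
    TimePartition.exists_refinement hab _ (by positivity)
  choose u hud hur using hex
  have hu := TimePartition.tendsto_diamToZero_of_diam_le hud
  have hnoise : ∀ n, IsCentredNoise P (fun j => 𝓕 ((u n).pt j.castSucc))
      (fun j ω => W ((u n).pt j.succ) ω - W ((u n).pt j.castSucc) ω)
      (fun j => ((u n).pt j.succ : ℝ) - (u n).pt j.castSucc) := fun n => by
    simpa only [TimePartition.tag_zero] using hW.isCentredNoise_increment (u n) zero_le_one
  set Y : ∀ n, Fin (u n).n → Ω → ℝ := fun n k ω =>
    (H n).val ((u n).pt k.succ) ω - Φ (W ((u n).pt k.castSucc) ω)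
  -- Although `H n` is evaluated at the right end point, its value there is `ξ j` for a coarse cell
  -- containing the fine one, so it is known at an earlier or equal left end point.
  have hY : ∀ n k, Measurable[𝓕 ((u n).pt k.castSucc)] (Y n k) := by
    intro n k
    refine Measurable.sub (Finset.measurable_fun_sum _ fun j _ => ?_)
      (hc.measurable.comp (hW.measurable_le le_rfl))
    by_cases hm : (u n).pt k.succ ∈ Set.Ioc ((H n).pt j.castSucc) ((H n).pt j.succ)
    · simp only [Set.indicator_of_mem hm]
      exact ((H n).measurable_ξ j).mono
        (𝓕.mono (((hur n).mem_Ioc_iff j k ((u n).right_mem_Ioc k)).1 hm).1) le_rfl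
    · simp only [Set.indicator_of_notMem hm]
      exact measurable_const
  have hb : TendstoInMeasure P (fun n ω => ∑ k, Y n k ω ^ 2 *
      (((u n).pt k.succ : ℝ) - (u n).pt k.castSucc)) atTop (fun _ => 0) := by
    refine tendstoInMeasure_of_controlled (tendsto_measure_ge_iff_tendstoInMeasure_min.1 hH)
      (fun n => ?_) ?_
    · exact (Finset.measurable_fun_sum _ fun k _ =>
        (((hY n k).mono (𝓕.le _) le_rfl).pow_const 2).mul_const _).aestronglyMeasurable
    · filter_upwards [hW.isBrownian.cont] with ω hω v hv hq
      rw [Metric.tendsto_nhds]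
      intro ε hε
      -- Gives `2 η² (b - a) = ε / 4`; with the integral below `ε / 4`, the bracket is less than `ε
      -- / 2 + ε / 4 < ε`.
      have hη : 0 < √(ε / (8 * (b - a))) := by positivity
      filter_upwards [(hu.comp hv).eventually (TimePartition.eventually_osc_le (hc.comp hω) hη),
        hq.eventually (eventually_lt_nhds (show (0 : ℝ) < min 1 (ε / 4) by positivity))]
        with i h1 h2
      have hnn : 0 ≤ ∑ k, Y (v i) k ω ^ 2 *
          (((u (v i)).pt k.succ : ℝ) - (u (v i)).pt k.castSucc) :=
        Finset.sum_nonneg fun k _ => mul_nonneg (sq_nonneg _) ((u (v i)).length_nonneg k)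
      rw [dist_zero_right, Real.norm_eq_abs, abs_of_nonneg hnn]
      have h3 := (hur (v i)).sum_sq_le (fun j => (H (v i)).ξ j ω) (fun t => Φ (W t ω))
        (η := √(ε / (8 * (b - a)))) fun k t ht => h1 k t ht _ ⟨le_rfl, (u (v i)).pt_le k⟩
      rw [Real.sq_sqrt (by positivity)] at h3
      set G := ∫⁻ t in Set.Icc (a : ℝ) b,
        ‖(H (v i)).stepFun (fun j => (H (v i)).ξ j ω) t.toNNReal - Φ (W t.toNNReal ω)‖ₑ ^ 2
      have h2' : (min 1 G).toReal < min 1 (ε / 4) := h2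
      have hG1 : G < 1 := by
        by_contra hge
        rw [min_eq_left (not_lt.1 hge)] at h2'
        simp at h2'
      rw [min_eq_right hG1.le] at h2'
      have hG : G = ENNReal.ofReal G.toReal :=
        (ENNReal.ofReal_toReal (hG1.trans ENNReal.one_lt_top).ne).symm
      rw [hG, ← ENNReal.ofReal_ofNat 2, ← ENNReal.ofReal_mul (by norm_num),
        ← ENNReal.ofReal_mul (by norm_num), ← ENNReal.ofReal_add (by positivity) (by positivity),
        ENNReal.ofReal_le_ofReal_iff (by positivity)] at h3
      refine lt_of_le_of_lt h3 ?_
      have h4 := h2'.trans_le (min_le_right _ _)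
      have h5 : ε / (8 * ((b : ℝ) - a)) * (b - a) = ε / 8 := by field_simp
      rw [h5]
      linarith
  -- Transform plus left-point sum on the refinement is the integral of `H n` over the refinement,
  -- which `Refines.sum_eq` identifies with the original one.
  have h := tendstoInMeasure_add (tendstoInMeasure_transform hnoise hY hb)
    ((hW.tendstoInMeasure_leftSum (a := a) (b := b) hΦ).comp hu)
  simp only [zero_add] at h
  refine h.congr_left fun n => Eventually.of_forall fun ω => ?_
  have e := (hur n).sum_eq (fun j => (H n).ξ j ω) (fun t => W t ω)
  simp only [Function.comp, leftSum, Y]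
  rw [← Finset.sum_add_distrib, ItoSimpleProcess.integral, ← e]
  refine Finset.sum_congr rfl fun k _ => ?_
  rw [← add_mul, sub_add_cancel]
  rfl

end IsFilteredBrownian

end ItoIntegral

theorem theorem6p2 {Ω : Type*} {mΩ : MeasurableSpace Ω} (P : Measure Ω) [IsProbabilityMeasure P]
    (𝓕 : Filtration ℝ≥0 mΩ) (W : ℝ≥0 → Ω → ℝ) (hW : IsFilteredBrownian W 𝓕 P)
    (a b : ℝ≥0) (hab : a < b) (Φ : ℝ → ℝ) (hΦ : ContDiff ℝ 1 Φ) :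
    (∃ S : Ω → ℝ, IsFehlbergIntegral P W Φ a b S) ∧
    (∃ I : Ω → ℝ, IsItoIntegral P 𝓕 W (fun t ω => Φ (W t ω)) a b I) ∧
    (∀ᵐ ω ∂P, IntervalIntegrable (fun t : ℝ => deriv Φ (W t.toNNReal ω)) volume a b) ∧
    ∀ S I : Ω → ℝ, IsFehlbergIntegral P W Φ a b S →
      IsItoIntegral P 𝓕 W (fun t ω => Φ (W t ω)) a b I →
      ∀ᵐ ω ∂P, S ω = I ω +
        (255 / 512 : ℝ) * ∫ t in (a : ℝ)..(b : ℝ), deriv Φ (W t.toNNReal ω) := by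
  have hS := hW.tendstoInMeasure_fehlbergSum (a := a) (b := b) hΦ
  have := TimePartition.diamToZero_neBot hab
  refine ⟨⟨_, ?_, hS⟩, ⟨_, hW.exists_isItoIntegral hab hΦ⟩, ?_, fun S I hS' hI' => ?_⟩
  · obtain ⟨u, hu⟩ := TimePartition.exists_seq_tendsto_diamToZero hab
    exact (hS.comp hu).aemeasurable fun n =>
      (hW.measurable_fehlbergSum hΦ.continuous (u n)).aemeasurable
  · filter_upwards [hW.isBrownian.cont] with ω hω
    exact (hΦ.continuous_deriv_one.comp
      (hω.comp continuous_real_toNNReal)).intervalIntegrable _ _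
  -- An arbitrary version `I` brings its own approximating sequence; by the independence result its
  -- integrals also tend to `itoLimit`, and limits in measure are almost everywhere unique.
  · obtain ⟨-, -, -, H, hH, hI⟩ := hI'
    filter_upwards [tendstoInMeasure_ae_unique hS'.2 hS,
      tendstoInMeasure_ae_unique hI (hW.tendstoInMeasure_simpleIntegral hab hΦ hH)] with ω h1 h2
    rw [h1, h2]
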